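/- Let $V$ be a separable Banach space, $I=\{0,1,\dots,T\}$, $r\ge 0$, and let $U\subset V$ be a Borel set. Let $\mathcal S(U)$ be the class of adapted processes $\mathbf X=(\Omega,\mathbb P,(\mathcal F_t)_{t\in I},(X_t)_{t\in I})$ with values in $U$ (a probability space, a filtration and an adapted $U$-valued process). *Adapted topology.* Adapted functionals are built from (i) $\mathbf X\mapsto f(X_{t_1},\dots,X_{t_n})$ with $f\in C_b(U^n)$; (ii) $\mathbf X\mapsto g(f_1(\mathbf X),\dots,f_n(\mathbf X))$ with $g\in C_b(\mathbb R^n)$ and adapted functionals $f_i$; (iii) $\mathbf X\mapsto \mathbb E[f(\mathbf X)\mid\mathcal F_t]$ with $f$ an adapted functional. The rank is the depth of nesting of step (iii). Let $\tau_r$ be the initial topology on $\mathcal S(U)$ of the maps $\mathbf X\mapsto\mathbb E[f(\mathbf X)]$, $f$ an adapted functional of rank at most $r$. *Extended weak topology.* Put $\mathrm{Prob}_0(U)=U$ and $\mathrm{Prob}_{k+1}(U)=\mathrm{Prob}(\mathrm{Prob}_k(U)^I)$ with the weak topology. Put $\hat X^0=X$ and let $\hat X^{k+1}_t$ be the regular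 conditional law of the path $\hat X^k$ given $\mathcal F_t$, a random element of $\mathrm{Prob}_{k+1}(U)$. Let $\hat\tau_r$ be the initial topology on $\mathcal S(U)$ of the maps $\mathbf X\mapsto\mathbb E[f(\hat X^r)]$, $f\in C_b(\mathrm{Prob}_r(U)^I)$. *Higher rank signatures.* For every Banach space $F$ used below fix admissible norms on the algebraic tensor powers $F^{\otimes m}$, $m\ge0$: the given norm for $m=1$, norm one of the unit for $m=0$, invariant under permutation of the factors of elementary tensors, $\|u\otimes v\|\le\|u\|\,\|v\|$, and such that $\ell_1\otimes\dots\otimes\ell_m$ is continuous for all $\ell_i\in F^*$ (for instance the projective norms). Put $\mathbf T^0(V)=V$ and let $\mathbf T^{k+1}(V)$ be the completion of $\bigoplus_{m\ge0}(\mathbb R\oplus\mathbf T^k(V))^{\otimes m}$ for the norm $\|t\|=\sum_m\|t_m\|$, where $\mathbb R\oplus \mathbf T^k(V)$ has the norm $|a|+\|v\|$. For $x\in\mathbf T^k(V)^I$ let $\mathrm S(x)=\exp(\Delta_0x)\otimes\exp(\Delta_1x)\otimes\cdots\otimes\exp(\Delta_Tx)\in\mathbf T^{k+1}(V)$ be its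 signature, with $\Delta_0x=(1,x_0)$, $\Delta_tx=(1,x_t-x_{t-1})$ and $\exp(v)=\sum_m v^{\otimes m}/m!$. A tensor normalization on $\mathbf T^{k+1}(V)$ is a continuous, injective and bounded map on $\{t: t_0=1\}$ of the form $t\mapsto(t_0,\lambda(t)t_1,\lambda(t)^2t_2,\dots)$ with $\lambda(t)>0$. Choose either the identity on $\mathbf T^{k+1}(V)$ for every $k$ (classical signatures), or a tensor normalization on $\mathbf T^{k+1}(V)$ for every $k$ (robust signatures), and call this map $\Lambda$. Define $\mathrm{ESig}^0:U\to V$ as the inclusion, $$\mathrm{ESig}^{k+1}(\mu)=\int \Lambda\,\mathrm S\big(t\mapsto\mathrm{ESig}^k(x_t)\big)\,\mu(dx)\in\mathbf T^{k+1}(V),\qquad \mu\in\mathrm{Prob}_{k+1}(U),$$ and $\Phi_r(\mathbf X)=\mathrm{ESig}^{r+1}(\mathrm{Law}(\hat X^r))\in\mathbf T^{r+1}(V)$, $d_r(\mathbf X,\mathbf Y)=\|\Phi_r(\mathbf X)-\Phi_r(\mathbf Y)\|$. **Theorem.** 1. If $U$ is compact then, for classical as well as for robust signatures, the following four topologies on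 $\mathcal S(U)$ are equal: the adapted topology $\tau_r$; the extended weak topology $\hat\tau_r$; the initial topology of $\Phi_r:\mathcal S(U)\to\mathbf T^{r+1}(V)$ for the norm topology on $\mathbf T^{r+1}(V)$; the topology induced by the semimetric $d_r$. 2. For an arbitrary Borel set $U$ and robust signatures, the same holds locally: for every $\mathcal K\subset\mathcal S(U)$ that is compact for $\hat\tau_r$, the four topologies induce the same topology on $\mathcal K$. -/

import Mathlib

open MeasureTheory TopologicalSpace Filter Topology ProbabilityTheory
open scoped BoundedContinuousFunction NNReal ENNReal unitInterval TensorProduct Nat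

universe u w

noncomputable section

namespace AdaptedTop

/-! ### Spaces of probability measures with the weak topology

For a separable metrizable Borel space `E` that is standard Borel, the same holds for the space of
probability measures on `E`; this is what is needed to iterate regular conditional laws. -/

section ProbabilitySpaces

theorem exists_isEmbedding_hilbertCube (E : Type u) [TopologicalSpace E] [MetrizableSpace E]
    [SecondCountableTopology E] : ∃ F : E → ℕ → I, IsEmbedding F := by
  let := metrizableSpaceMetric E
  exact Metric.PiNatEmbed.exists_embedding_to_hilbert_cube

variable {E : Type u} [TopologicalSpace E] [MetrizableSpace E] [SecondCountableTopology E]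
  [MeasurableSpace E] [BorelSpace E]

theorem isEmbedding_map {F : E → ℕ → I} (hF : IsEmbedding F) :
    IsEmbedding (fun μ : ProbabilityMeasure E =>
      μ.map (f := F) hF.continuous.measurable.aemeasurable) := by
  set j := fun μ : ProbabilityMeasure E => μ.map (f := F) hF.continuous.measurable.aemeasurable
  have hj : Continuous j := ProbabilityMeasure.continuous_map hF.continuous
  have hind : IsInducing j := by
    rw [isInducing_iff_nhds]
    intro μ
    refine le_antisymm (hj.tendsto μ).le_comap ?_
    refine tendsto_of_forall_isOpen_le_liminf' (μs := fun ν => ν) (L := comap j (𝓝 (j μ))) ?_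
    intro G hG
    obtain ⟨G', hG', rfl⟩ := hF.isOpen_iff.1 hG
    have h := ProbabilityMeasure.le_liminf_measure_open_of_tendsto
      (tendsto_comap (f := j) (x := 𝓝 (j μ))) hG'
    have e : ∀ ν : ProbabilityMeasure E, (j ν : Measure (ℕ → I)) G' = (ν : Measure E) (F ⁻¹' G') :=
      fun ν => by
        simp only [j, ProbabilityMeasure.toMeasure_map]
        exact Measure.map_apply hF.continuous.measurable hG'.measurableSet
    simpa only [e] using h
  exact ⟨hind, hind.injective⟩

instance secondCountable_probabilityMeasure : SecondCountableTopology (ProbabilityMeasure E) := by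
  obtain ⟨F, hF⟩ := exists_isEmbedding_hilbertCube E
  exact (isEmbedding_map hF).isInducing.secondCountableTopology

/-- The `σ`-algebra generated by the evaluations `μ ↦ μ s` is the Borel `σ`-algebra of the weak
topology. -/
instance borelSpace_probabilityMeasure : BorelSpace (ProbabilityMeasure E) := by
  refine ⟨le_antisymm ?_ ?_⟩
  · have h : @Measurable _ _ (borel (ProbabilityMeasure E)) _
        (fun μ : ProbabilityMeasure E => (μ : Measure E)) := by
      let : MeasurableSpace (ProbabilityMeasure E) := borel _
      have : BorelSpace (ProbabilityMeasure E) := ⟨rfl⟩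
      refine Measurable.measure_of_isPiSystem_of_isProbabilityMeasure
        (BorelSpace.measurable_eq (α := E)) isPiSystem_isOpen ?_
      intro G hG
      exact (lowerSemicontinuous_iff_le_liminf.2 fun μ =>
        ProbabilityMeasure.le_liminf_measure_open_of_tendsto tendsto_id hG).measurable
    exact h.comap_le
  · have ht : (inferInstance : TopologicalSpace (ProbabilityMeasure E)) =
        generateFrom (⋃ f : E →ᵇ ℝ≥0, {s | ∃ O : Set ℝ≥0, IsOpen O ∧
          (fun μ : ProbabilityMeasure E => μ.toFiniteMeasure.testAgainstNN f) ⁻¹' O = s}) := by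
      rw [generateFrom_iUnion]
      refine le_antisymm (le_iInf fun f => ?_) ?_
      · refine le_generateFrom ?_
        rintro s ⟨O, hO, rfl⟩
        exact hO.preimage (ProbabilityMeasure.continuous_testAgainstNN_eval f)
      · refine continuous_id_iff_le.1 ?_
        let t : TopologicalSpace (ProbabilityMeasure E) := ⨅ f : E →ᵇ ℝ≥0, generateFrom
          {s | ∃ O : Set ℝ≥0, IsOpen O ∧
          (fun μ : ProbabilityMeasure E => μ.toFiniteMeasure.testAgainstNN f) ⁻¹' O = s}
        refine continuous_induced_rng.2 (continuous_induced_rng.2 ?_)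
        refine WeakBilin.continuous_of_continuous_eval _ fun f => ?_
        refine continuous_iInf_dom (i := f) ?_
        exact continuous_def.2 fun O hO => isOpen_generateFrom_of_mem ⟨O, hO, rfl⟩
    rw [borel_eq_generateFrom_of_subbasis ht]
    refine MeasurableSpace.generateFrom_le ?_
    intro s hs
    obtain ⟨f, O, hO, rfl⟩ := Set.mem_iUnion.1 hs
    refine hO.measurableSet.preimage ?_
    exact ((Measure.measurable_lintegral (by fun_prop)).comp measurable_subtype_coe).ennreal_toNNReal

instance standardBorel_probabilityMeasure [StandardBorelSpace E] :
    StandardBorelSpace (ProbabilityMeasure E) := by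
  obtain ⟨F, hF⟩ := exists_isEmbedding_hilbertCube E
  have hm := hF.continuous.measurable.measurableEmbedding hF.injective
  have hj := isEmbedding_map hF
  have hjr : MeasurableSet (Set.range fun μ : ProbabilityMeasure E =>
      μ.map (f := F) hF.continuous.measurable.aemeasurable) := by
    have : (Set.range fun μ : ProbabilityMeasure E =>
        μ.map (f := F) hF.continuous.measurable.aemeasurable) =
        (fun ν : ProbabilityMeasure (ℕ → I) => (ν : Measure (ℕ → I)) (Set.range F)) ⁻¹' {1} := by
      ext ν
      constructor
      · rintro ⟨μ, rfl⟩
        simp only [Set.mem_preimage, Set.mem_singleton_iff, ProbabilityMeasure.toMeasure_map]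
        rw [Measure.map_apply hF.continuous.measurable hm.measurableSet_range]
        simp
      · intro h
        have hr : (ν : Measure (ℕ → I)).restrict (Set.range F) = ν := by
          refine Measure.restrict_eq_self_of_ae_mem ?_
          exact (prob_compl_eq_zero_iff hm.measurableSet_range).2 h
        have hmap : ((ν : Measure (ℕ → I)).comap F).map F = ν := by
          rw [hm.map_comap, hr]
        have hp : IsProbabilityMeasure ((ν : Measure (ℕ → I)).comap F) := by
          refine ⟨?_⟩
          have := congrArg (fun m : Measure (ℕ → I) => m Set.univ) hmap
          simpa [Measure.map_apply hF.continuous.measurable] using this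
        exact ⟨⟨_, hp⟩, Subtype.ext hmap⟩
    rw [this]
    exact ((Measure.measurable_coe hm.measurableSet_range).comp measurable_subtype_coe)
      (measurableSet_singleton 1)
  have he := hj.measurableEmbedding hjr
  have : PolishSpace (ProbabilityMeasure (ℕ → I)) := by
    let := metrizableSpaceMetric (ProbabilityMeasure (ℕ → I))
    infer_instance
  obtain ⟨t, hb, hp⟩ := hjr.standardBorel.polish
  refine ⟨t.induced he.equivRange, ?_, he.equivRange.toEquiv.polishSpace_induced⟩
  refine @BorelSpace.mk _ (t.induced he.equivRange) _ ?_
  rw [borel_comap, ← hb.measurable_eq]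
  exact he.equivRange.measurableEmbedding.comap_eq.symm

end ProbabilitySpaces

/-- The class of state spaces: separable metrizable spaces with their Borel `σ`-algebra that are
standard Borel (for instance Borel subsets of a separable Banach space). -/
structure State : Type (u + 1) where
  /-- the underlying type -/
  carrier : Type u
  [top : TopologicalSpace carrier]
  [metrizable : MetrizableSpace carrier]
  [secondCountable : SecondCountableTopology carrier]
  [meas : MeasurableSpace carrier]
  [borel : BorelSpace carrier]
  [standardBorel : StandardBorelSpace carrier]

attribute [instance] State.top State.metrizable State.secondCountable State.meas State.borel
  State.standardBorel

instance : CoeSort State (Type u) := ⟨State.carrier⟩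

/-- A Borel subset `U` of a separable Banach space as a state space. -/
abbrev State.ofSet {V : Type u} [NormedAddCommGroup V] [CompleteSpace V] [SeparableSpace V]
    [MeasurableSpace V] [BorelSpace V] (U : Set V) (hU : MeasurableSet U) : State.{u} :=
  haveI := UniformSpace.secondCountable_of_separable V
  haveI := hU.standardBorel
  { carrier := U }

/-- The inclusion of the state space `U` into `V`. -/
def State.incl {V : Type u} [NormedAddCommGroup V] [CompleteSpace V] [SeparableSpace V]
    [MeasurableSpace V] [BorelSpace V] (U : Set V) (hU : MeasurableSet U) :
    State.ofSet U hU → V :=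
  fun x : U => (x : V)

/-- `Prob(I → E)` with the weak topology, where `I = {0, …, T}`. -/
abbrev State.probPath (T : ℕ) (E : State.{u}) : State.{u} where
  carrier := ProbabilityMeasure (Fin (T + 1) → E)

/-- Rank `r` probability measures: `Prob_0(E) = E` and `Prob_{r+1}(E) = Prob(I → Prob_r(E))`. -/
def rankProb (T : ℕ) (E : State.{u}) : ℕ → State.{u}
  | 0 => E
  | r + 1 => (rankProb T E r).probPath T

/-! ### Adapted processes and prediction processes -/

/-- An adapted stochastic process `(Ω, P, (ℱ_t), (X_t))` in the state space `E`, indexed by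
`I = {0, …, T}`. -/
structure AdaptedProcess (T : ℕ) (E : State.{u}) : Type (max u (w + 1)) where
  /-- sample space -/
  Ω : Type w
  [mΩ : MeasurableSpace Ω]
  /-- probability measure -/
  P : Measure Ω
  [isProb : IsProbabilityMeasure P]
  /-- filtration -/
  ℱ : Filtration (Fin (T + 1)) mΩ
  /-- the process -/
  X : Fin (T + 1) → Ω → E
  adapted : ∀ t, Measurable[ℱ t] (X t)

attribute [instance] AdaptedProcess.mΩ AdaptedProcess.isProb

namespace AdaptedProcess

variable {T : ℕ} {E : State.{u}}

/-- The path `t ↦ X_t(ω)`. -/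
def path (X : AdaptedProcess.{u, w} T E) (ω : X.Ω) : Fin (T + 1) → E := fun t => X.X t ω

theorem measurable_path (X : AdaptedProcess.{u, w} T E) : Measurable X.path :=
  measurable_pi_lambda _ fun t => (X.adapted t).mono (X.ℱ.le t) le_rfl

theorem nonempty_path (X : AdaptedProcess.{u, w} T E) : Nonempty (Fin (T + 1) → E) :=
  (nonempty_of_isProbabilityMeasure X.P).map X.path

/-- The law `P ∘ X⁻¹` on the path space. -/
def law (X : AdaptedProcess.{u, w} T E) : ProbabilityMeasure (Fin (T + 1) → E) :=
  ⟨X.P.map X.path, Measure.isProbabilityMeasure_map X.measurable_path.aemeasurable⟩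

/-- The regular conditional law of the whole path given `ℱ_t`. -/
def condLaw (X : AdaptedProcess.{u, w} T E) (t : Fin (T + 1)) :
    @Kernel X.Ω (Fin (T + 1) → E) (X.ℱ t) _ :=
  haveI := X.nonempty_path
  @condDistrib X.Ω X.Ω (Fin (T + 1) → E) _ _ _ X.mΩ (X.ℱ t) X.path id X.P _

theorem isProbabilityMeasure_condLaw (X : AdaptedProcess.{u, w} T E) (t : Fin (T + 1)) (ω : X.Ω) :
    IsProbabilityMeasure (X.condLaw t ω) := by
  unfold condLaw
  infer_instance

/-- The prediction process `X̂_t = P(X ∈ · | ℱ_t)`. -/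
def predict (X : AdaptedProcess.{u, w} T E) : AdaptedProcess.{u, w} T (E.probPath T) where
  Ω := X.Ω
  P := X.P
  ℱ := X.ℱ
  X t ω := ⟨X.condLaw t ω, X.isProbabilityMeasure_condLaw t ω⟩
  adapted t := @Measurable.subtype_mk _ _ (X.ℱ t) _ _ _
    (@Kernel.measurable _ _ (X.ℱ t) _ (X.condLaw t)) _

/-- The prediction process of rank `r`. -/
def predictRank (X : AdaptedProcess.{u, w} T E) :
    (r : ℕ) → AdaptedProcess.{u, w} T (rankProb T E r)
  | 0 => X
  | r + 1 => (X.predictRank r).predict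

end AdaptedProcess

/-! ### Adapted functionals -/

/-- Constructions of adapted functionals. -/
inductive AdaptedFunctional (T : ℕ) (E : State.{u}) : Type u
  /-- `X ↦ f(X_{t_1}, …, X_{t_n})` -/
  | base (n : ℕ) (t : Fin n → Fin (T + 1)) (f : (Fin n → E) →ᵇ ℝ) : AdaptedFunctional T E
  /-- `X ↦ g(f_1(X), …, f_n(X))` -/
  | comp (n : ℕ) (f : Fin n → AdaptedFunctional T E) (g : (Fin n → ℝ) →ᵇ ℝ) : AdaptedFunctional T E
  /-- `X ↦ E[f(X) | ℱ_t]` -/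
  | cond (f : AdaptedFunctional T E) (t : Fin (T + 1)) : AdaptedFunctional T E

namespace AdaptedFunctional

variable {T : ℕ} {E : State.{u}}

/-- The number of nested conditional expectations. -/
def rank : AdaptedFunctional T E → ℕ
  | base _ _ _ => 0
  | comp _ f _ => Finset.univ.sup fun i => (f i).rank
  | cond f _ => f.rank + 1

/-- The random variable `f(X)`. -/
def eval (X : AdaptedProcess.{u, w} T E) : AdaptedFunctional T E → X.Ω → ℝ
  | base _ t f => fun ω => f fun i => X.X (t i) ω
  | comp _ f g => fun ω => g fun i => (f i).eval X ω
  | cond f t => X.P[f.eval X | X.ℱ t]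

end AdaptedFunctional

/-- The adapted topology `τ_r`: the initial topology of the maps `X ↦ E[f(X)]`, where `f` ranges
over the adapted functionals of rank at most `r`. -/
abbrev adaptedTopology (T : ℕ) (E : State.{u}) (r : ℕ) : TopologicalSpace (AdaptedProcess.{u, w} T E) :=
  ⨅ f : {f : AdaptedFunctional T E // f.rank ≤ r},
    induced (fun X : AdaptedProcess.{u, w} T E => ∫ ω, f.1.eval X ω ∂X.P) inferInstance

/-- The extended weak topology `τ̂_r`: the initial topology of the maps `X ↦ E[f(X̂^r)]`, where `f`
ranges over the bounded continuous functions on the path space of `X̂^r`. -/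
abbrev extendedWeakTopology (T : ℕ) (E : State.{u}) (r : ℕ) :
    TopologicalSpace (AdaptedProcess.{u, w} T E) :=
  ⨅ f : (Fin (T + 1) → rankProb T E r) →ᵇ ℝ,
    induced (fun X : AdaptedProcess.{u, w} T E =>
      ∫ ω, f ((X.predictRank r).path ω) ∂(X.predictRank r).P) inferInstance

/-! ### Tensor algebras -/

/-- An admissible system of norms on the tensor powers of a normed space `F`. Besides symmetry on
elementary tensors and submultiplicativity, tensor products of continuous functionals are
required to be continuous, as for every norm between the injective and the projective one. -/
structure AdmissibleNorm (F : Type u) [NormedAddCommGroup F] [NormedSpace ℝ F] : Type u where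
  /-- the norm on `F^{⊗ m}` -/
  nrm : (m : ℕ) → Seminorm ℝ (⨂[ℝ]^m F)
  eq_zero : ∀ m (u : ⨂[ℝ]^m F), nrm m u = 0 → u = 0
  nrm_unit : nrm 0 (PiTensorProduct.tprod ℝ Fin.elim0) = 1
  nrm_one : ∀ v : F, nrm 1 (PiTensorProduct.tprod ℝ fun _ => v) = ‖v‖
  nrm_perm : ∀ m (v : Fin m → F) (p : Equiv.Perm (Fin m)),
    nrm m (PiTensorProduct.tprod ℝ (v ∘ p)) = nrm m (PiTensorProduct.tprod ℝ v)
  nrm_mul_le : ∀ m n (u : ⨂[ℝ]^m F) (v : ⨂[ℝ]^n F),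
    nrm (m + n) (TensorPower.mulEquiv (u ⊗ₜ[ℝ] v)) ≤ nrm m u * nrm n v
  functional_bound : ∀ m (ℓ : Fin m → StrongDual ℝ F), ∃ C : ℝ, ∀ u : ⨂[ℝ]^m F,
    |PiTensorProduct.lift ((MultilinearMap.mkPiAlgebra ℝ (Fin m) ℝ).compLinearMap
      fun i => (ℓ i : F →ₗ[ℝ] ℝ)) u| ≤ C * nrm m u

section TensorAlgebra

variable {F : Type u} [NormedAddCommGroup F] [NormedSpace ℝ F]

/-- `F^{⊗ m}` as a type that carries the chosen norm. -/
def NormedPower (_N : AdmissibleNorm F) (m : ℕ) : Type u := ⨂[ℝ]^m F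

instance (N : AdmissibleNorm F) (m : ℕ) : AddCommGroup (NormedPower N m) :=
  inferInstanceAs (AddCommGroup (⨂[ℝ]^m F))

instance (N : AdmissibleNorm F) (m : ℕ) : Module ℝ (NormedPower N m) :=
  inferInstanceAs (Module ℝ (⨂[ℝ]^m F))

instance (N : AdmissibleNorm F) (m : ℕ) : SeminormedAddCommGroup (NormedPower N m) :=
  AddGroupSeminorm.toSeminormedAddCommGroup (E := NormedPower N m) (N.nrm m).toAddGroupSeminorm

instance (N : AdmissibleNorm F) (m : ℕ) : NormedSpace ℝ (NormedPower N m) where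
  norm_smul_le a u := (map_smul_eq_mul (N.nrm m) a u).le

/-- The inclusion of `F^{⊗ m}` into its completion for the chosen norm. -/
def toCompletion (N : AdmissibleNorm F) {m : ℕ} (u : ⨂[ℝ]^m F) :
    UniformSpace.Completion (NormedPower N m) :=
  UniformSpace.Completion.coe' (α := NormedPower N m) u

theorem norm_toCompletion (N : AdmissibleNorm F) {m : ℕ} (u : ⨂[ℝ]^m F) :
    ‖toCompletion N u‖ = N.nrm m u :=
  UniformSpace.Completion.norm_coe (E := NormedPower N m) u

/-- The completion of `⨁_m F^{⊗ m}` for the norm `‖t‖ = ∑_m ‖t_m‖`, realised as the `ℓ¹`-sum of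
the completions of the `F^{⊗ m}`. -/
abbrev TensorAlg (N : AdmissibleNorm F) : Type u :=
  lp (fun m => UniformSpace.Completion (NormedPower N m)) 1

/-- Formal tensor series `∏_m F^{⊗ m}`. -/
abbrev TensorSeries (F : Type u) [NormedAddCommGroup F] [NormedSpace ℝ F] : Type u :=
  (m : ℕ) → ⨂[ℝ]^m F

/-- The unit `(1, 0, 0, …)`. -/
def TensorSeries.one : TensorSeries F
  | 0 => PiTensorProduct.tprod ℝ Fin.elim0
  | _ + 1 => 0

/-- The tensor exponential `v ↦ (v^{⊗ m} / m!)_m`. -/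
def TensorSeries.exp (v : F) : TensorSeries F :=
  fun m => (m ! : ℝ)⁻¹ • PiTensorProduct.tprod ℝ fun _ => v

/-- The tensor convolution product `(s · t)_m = ∑_{i ≤ m} s_i ⊗ t_{m-i}`. -/
def TensorSeries.mul (s t : TensorSeries F) : TensorSeries F := fun m =>
  ∑ i : Fin (m + 1), TensorPower.cast ℝ F (Nat.add_sub_cancel' (Nat.le_of_lt_succ i.2))
    (TensorPower.mulEquiv (s i ⊗ₜ[ℝ] t (m - i)))

theorem AdmissibleNorm.nrm_cast (N : AdmissibleNorm F) {m n : ℕ} (h : m = n) (u : ⨂[ℝ]^m F) :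
    N.nrm n (TensorPower.cast ℝ F h u) = N.nrm m u := by
  subst h
  simp

theorem AdmissibleNorm.nrm_tprod_const_le (N : AdmissibleNorm F) (v : F) (m : ℕ) :
    N.nrm m (PiTensorProduct.tprod ℝ fun _ => v) ≤ ‖v‖ ^ m := by
  induction m with
  | zero =>
    rw [show (fun _ : Fin 0 => v) = Fin.elim0 from funext fun i => i.elim0, N.nrm_unit]
    simp
  | succ m ih =>
    have h : (PiTensorProduct.tprod ℝ fun _ : Fin (m + 1) => v) =
        TensorPower.mulEquiv ((PiTensorProduct.tprod ℝ fun _ : Fin m => v) ⊗ₜ[ℝ]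
          (PiTensorProduct.tprod ℝ fun _ : Fin 1 => v)) := by
      rw [← TensorPower.gMul_def, TensorPower.tprod_mul_tprod]
      congr 1
      funext i
      refine Fin.addCases (fun j => ?_) (fun j => ?_) i <;> simp
    rw [h, pow_succ]
    refine (N.nrm_mul_le _ _ _ _).trans ?_
    rw [N.nrm_one]
    gcongr

theorem AdmissibleNorm.summable_exp (N : AdmissibleNorm F) (v : F) :
    Summable fun m => N.nrm m (TensorSeries.exp v m) := by
  refine Summable.of_nonneg_of_le (fun m => apply_nonneg _ _) (fun m => ?_)
    (Real.summable_pow_div_factorial ‖v‖)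
  simp only [TensorSeries.exp, map_smul_eq_mul, norm_inv, RCLike.norm_natCast]
  rw [div_eq_inv_mul]
  gcongr
  exact N.nrm_tprod_const_le v m

theorem AdmissibleNorm.summable_mul (N : AdmissibleNorm F) {s t : TensorSeries F}
    (hs : Summable fun m => N.nrm m (s m)) (ht : Summable fun m => N.nrm m (t m)) :
    Summable fun m => N.nrm m (s.mul t m) := by
  have h := summable_norm_sum_mul_range_of_summable_norm hs.norm ht.norm
  refine Summable.of_nonneg_of_le (fun m => apply_nonneg _ _) (fun m => ?_) h
  refine le_trans ?_ (le_abs_self _)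
  rw [← Fin.sum_univ_eq_sum_range (fun i => N.nrm i (s i) * N.nrm (m - i) (t (m - i))) (m + 1)]
  refine (Finset.le_sum_of_subadditive (N.nrm m) (map_zero _).le (map_add_le_add _) _ _).trans
    (Finset.sum_le_sum fun i _ => ?_)
  rw [N.nrm_cast]
  exact N.nrm_mul_le _ _ _ _

theorem AdmissibleNorm.summable_one (N : AdmissibleNorm F) :
    Summable fun m => N.nrm m (TensorSeries.one (F := F) m) := by
  refine summable_of_ne_finset_zero (s := {0}) fun m hm => ?_
  cases m with
  | zero => simp at hm
  | succ m => simp [TensorSeries.one]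

/-- The product `s_0 · s_1 ⋯ s_n` of a list of formal tensor series. -/
def TensorSeries.listProd (l : List (TensorSeries F)) : TensorSeries F :=
  l.foldr TensorSeries.mul TensorSeries.one

/-- The element of the tensor algebra defined by an absolutely summable tensor series. -/
def TensorSeries.toAlg (N : AdmissibleNorm F) (s : TensorSeries F)
    (hs : Summable fun m => N.nrm m (s m)) : TensorAlg N :=
  ⟨fun m => toCompletion N (s m), by
    refine memℓp_gen ?_
    simpa only [norm_toCompletion, ENNReal.toReal_one, Real.rpow_one] using hs⟩

end TensorAlgebra

/-! ### Signatures -/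

section Signature

/-- `ℝ ⊕ E` with the norm `|a| + ‖v‖`. -/
abbrev Aug (E : Type u) [NormedAddCommGroup E] [NormedSpace ℝ E] : Type u := WithLp 1 (ℝ × E)

variable {E : Type u} [NormedAddCommGroup E] [NormedSpace ℝ E] {T : ℕ}

/-- The time-augmented increments `Δ_0 x = (1, x_0)`, `Δ_t x = (1, x_t - x_{t-1})`. -/
def increment (x : Fin (T + 1) → E) (t : Fin (T + 1)) : Aug E :=
  WithLp.toLp 1 (1, Fin.cases (x 0) (fun s : Fin T => x s.succ - x s.castSucc) t)

/-- The signature `∏_{t ∈ I} exp(Δ_t x)` as a formal tensor series. -/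
def signatureSeries (x : Fin (T + 1) → E) : TensorSeries (Aug E) :=
  TensorSeries.listProd (List.ofFn fun t => TensorSeries.exp (increment x t))

theorem summable_signatureSeries (N : AdmissibleNorm (Aug E)) (x : Fin (T + 1) → E) :
    Summable fun m => N.nrm m (signatureSeries x m) := by
  have key : ∀ l : List (TensorSeries (Aug E)), (∀ s ∈ l, Summable fun m => N.nrm m (s m)) →
      Summable fun m => N.nrm m (TensorSeries.listProd l m) := by
    intro l
    induction l with
    | nil => exact fun _ => N.summable_one
    | cons a l ih =>
      intro h
      exact N.summable_mul (h a (by simp)) (ih fun s hs => h s (by simp [hs]))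
  refine key _ fun s hs => ?_
  obtain ⟨t, rfl⟩ := (List.mem_ofFn' _ _).1 hs
  exact N.summable_exp _

/-- The signature of a discrete-time path. -/
def signature (N : AdmissibleNorm (Aug E)) (x : Fin (T + 1) → E) : TensorAlg N :=
  (signatureSeries x).toAlg N (summable_signatureSeries N x)

/-- The tensors `t` with scalar component `t_0 = 1`. -/
def unitTensors (N : AdmissibleNorm (Aug E)) : Set (TensorAlg N) :=
  {t | t 0 = toCompletion N (PiTensorProduct.tprod ℝ Fin.elim0)}

/-- A tensor normalization: a bounded continuous injective map on the tensors with `t_0 = 1`, of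
the form `t ↦ δ_{λ(t)} t` with `λ(t) > 0`, where `δ_c t = (t_0, c t_1, c² t_2, …)`. -/
structure IsTensorNormalization (N : AdmissibleNorm (Aug E)) (Λ : TensorAlg N → TensorAlg N) :
    Prop where
  dilation : ∀ t ∈ unitTensors N, ∃ c : ℝ, 0 < c ∧ ∀ m, Λ t m = c ^ m • t m
  continuousOn : ContinuousOn Λ (unitTensors N)
  injOn : Set.InjOn Λ (unitTensors N)
  bounded : ∃ K : ℝ, ∀ t ∈ unitTensors N, ‖Λ t‖ ≤ K

end Signature

/-! ### Higher rank expected signatures -/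

/-- A real Banach space, bundled. -/
structure BSpace : Type (u + 1) where
  /-- the underlying type -/
  carrier : Type u
  [group : NormedAddCommGroup carrier]
  [space : NormedSpace ℝ carrier]
  [complete : CompleteSpace carrier]

attribute [instance] BSpace.group BSpace.space BSpace.complete

instance : CoeSort BSpace (Type u) := ⟨BSpace.carrier⟩

/-- A choice of admissible norms on the tensor powers of all normed spaces, one choice for each
rank. -/
abbrev AdmissibleNormSystem : Type (u + 1) :=
  ℕ → (F : Type u) → [NormedAddCommGroup F] → [NormedSpace ℝ F] → AdmissibleNorm F

section HigherRank

variable (N : AdmissibleNormSystem.{u}) (V : Type u) [NormedAddCommGroup V] [NormedSpace ℝ V]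
  [CompleteSpace V]

/-- The rank `k` tensor algebra: `T^0(V) = V` and `T^{k+1}(V) = T^1(T^k(V))` is the completion of
`⨁_m (ℝ ⊕ T^k(V))^{⊗ m}`. -/
def tensorSpace : ℕ → BSpace.{u}
  | 0 => ⟨V⟩
  | k + 1 => ⟨TensorAlg (N k (Aug (tensorSpace k)))⟩

/-- Maps that are applied to the signature, at each rank. -/
abbrev Lift : Type u := (k : ℕ) →
  TensorAlg (N k (Aug (tensorSpace N V k))) → TensorAlg (N k (Aug (tensorSpace N V k)))

/-- No normalization: this gives the classical signature. -/
def Lift.classical : Lift N V := fun _ t => t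

variable {N V}

/-- All the maps are tensor normalizations: this gives the robust signatures. -/
def Lift.IsNormalization (Λ : Lift N V) : Prop :=
  ∀ k, IsTensorNormalization (N k (Aug (tensorSpace N V k))) (Λ k)

variable {T : ℕ} {E : State.{u}}

/-- The expected signature of rank `r` of a rank `r` probability measure on `E`, where `ι` embeds
`E` into `V`: `ESig^0 = ι` and `ESig^{r+1}(μ) = ∫ Λ(S(t ↦ ESig^r(x_t))) μ(dx)`. -/
def expectedSignature (Λ : Lift N V) (ι : E → V) : (r : ℕ) → rankProb T E r → tensorSpace N V r
  | 0 => ι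
  | r + 1 => fun (μ : ProbabilityMeasure (Fin (T + 1) → rankProb T E r)) =>
    ∫ x : Fin (T + 1) → rankProb T E r, (show tensorSpace N V (r + 1) from
      Λ r (signature _ fun t => expectedSignature Λ ι r (x t)))
      ∂(μ : Measure (Fin (T + 1) → rankProb T E r))

/-- The map `Φ_r(X) = ESig^{r+1}(Law(X̂^r))`. -/
def Phi (Λ : Lift N V) (ι : E → V) (r : ℕ) (X : AdaptedProcess.{u, w} T E) :
    tensorSpace N V (r + 1) :=
  expectedSignature (T := T) Λ ι (r + 1) (X.predictRank r).law

/-- The initial topology of `Φ_r` for the norm topology on the tensor algebra. -/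
abbrev sigTopology (Λ : Lift N V) (ι : E → V) (r : ℕ) :
    TopologicalSpace (AdaptedProcess.{u, w} T E) :=
  induced (Phi Λ ι r) inferInstance

/-- The semimetric `d_r(X, Y) = ‖Φ_r(X) - Φ_r(Y)‖`. -/
def sigDist (Λ : Lift N V) (ι : E → V) (r : ℕ) (X Y : AdaptedProcess.{u, w} T E) : ℝ :=
  ‖Phi Λ ι r X - Phi Λ ι r Y‖

/-- The semimetric space given by `d_r`. -/
abbrev sigPseudoMetric (Λ : Lift N V) (ι : E → V) (r : ℕ) :
    PseudoMetricSpace (AdaptedProcess.{u, w} T E) where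
  dist := sigDist Λ ι r
  dist_self X := by simp [sigDist]
  dist_comm X Y := norm_sub_rev _ _
  dist_triangle X Y Z := norm_sub_le_norm_sub_add_norm_sub _ _ _

/-- The topology induced by the semimetric `d_r`. -/
abbrev sigDistTopology (Λ : Lift N V) (ι : E → V) (r : ℕ) :
    TopologicalSpace (AdaptedProcess.{u, w} T E) :=
  (sigPseudoMetric Λ ι r).toUniformSpace.toTopologicalSpace

end HigherRank

end AdaptedTop

end

/-! All four topologies are pulled back along one map: a process goes to the law of its rank `r`
prediction process, a point of the space of probability measures on rank `r` paths. There the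
extended weak topology comes from the weak topology, the adapted topology from a family of
integrals, and the signature topologies from the map `ESig^{r+1}`. The last two are coarser than the
weak topology and Hausdorff. A topology that is compact has no strictly coarser Hausdorff topology,
so they agree with the weak one on compact sets of laws; for compact `U` the whole space of laws is
compact. It remains to prove continuity and injectivity on both sides.

Adapted functionals. A functional of rank at most `r` is almost surely a bounded continuous function
of the rank `r` prediction process, the same function for every process (`exists_represents`). These
functions form an algebra that separates points (`representable_separates`), and such an algebra
determines measures (`measure_ext_of_subalgebra`).

Signatures. By induction on `k`, `ESig^k` is continuous and injective
(`continuous_injective_expectedSignature`). Continuity is that of Bochner integrals of bounded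
continuous functions (`continuous_integral_of_bounded`). For injectivity, scalar coordinates of the
normalized signature are shown to be closed under products and to separate paths, so their span is
again a measure-determining algebra (`injective_integral_signature`). The coordinates are entries of
matrix developments at a fixed tensor level: Kronecker sums of matrices replace the shuffle product,
and the constant time increments allow a path to be read off from its coordinates. -/

noncomputable section

namespace AdaptedTop

/-! ### Weak topology: measure-determining algebras and Bochner integrals. -/

section WeakTopology

variable {E : Type*} [TopologicalSpace E] [MeasurableSpace E]

theorem probabilityMeasure_topology_eq_iInf [OpensMeasurableSpace E] :
    (inferInstance : TopologicalSpace (ProbabilityMeasure E)) =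
      ⨅ f : E →ᵇ ℝ, induced (fun μ : ProbabilityMeasure E => ∫ x, f x ∂(μ : Measure E))
        inferInstance := by
  refine le_antisymm (le_iInf fun f => continuous_iff_le_induced.1
    (ProbabilityMeasure.continuous_integral_boundedContinuousFunction f)) ?_
  refine le_of_nhds_le_nhds fun μ => ?_
  refine ProbabilityMeasure.tendsto_iff_forall_integral_tendsto.2 fun f => ?_
  rw [nhds_iInf]
  refine Tendsto.mono_left ?_ (iInf_le _ f)
  rw [nhds_induced]
  exact tendsto_comap

/-- In a second countable space, a family of continuous functions that separates points has a
countable subfamily that separates points. -/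
theorem exists_countable_separating {X : Type*} [TopologicalSpace X] [SecondCountableTopology X]
    {A : Set (X →ᵇ ℝ)} (hA : ∀ x y, x ≠ y → ∃ f ∈ A, f x ≠ f y) :
    ∃ S ⊆ A, S.Countable ∧ ∀ x y, x ≠ y → ∃ f ∈ S, f x ≠ f y := by
  obtain ⟨S, hSc, hS⟩ := isOpen_iUnion_countable
    (fun f : A => {p : X × X | f.1 p.1 ≠ f.1 p.2}) fun f =>
      isOpen_ne_fun (f.1.continuous.comp continuous_fst) (f.1.continuous.comp continuous_snd)
  refine ⟨Subtype.val '' S, by simp, hSc.image _, fun x y hxy => ?_⟩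
  obtain ⟨f, hf, hne⟩ := hA x y hxy
  have : (x, y) ∈ ⋃ f : A, {p : X × X | f.1 p.1 ≠ f.1 p.2} := Set.mem_iUnion.2 ⟨⟨f, hf⟩, hne⟩
  rw [← hS] at this
  obtain ⟨g, hg, hgne⟩ := Set.mem_iUnion₂.1 this
  exact ⟨g, ⟨g, hg, rfl⟩, hgne⟩

/-- On a second countable standard Borel space, a subalgebra of bounded continuous functions that
separates points separates finite measures. -/
theorem measure_ext_of_subalgebra [SecondCountableTopology E] [BorelSpace E]
    [StandardBorelSpace E] {μ ν : Measure E} [IsFiniteMeasure μ] [IsFiniteMeasure ν]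
    (A : Subalgebra ℝ (E →ᵇ ℝ)) (hA : ∀ x y, x ≠ y → ∃ f ∈ A, f x ≠ f y)
    (h : ∀ f ∈ A, ∫ x, f x ∂μ = ∫ x, f x ∂ν) : μ = ν := by
  obtain ⟨S, hSA, hSc, hS⟩ := exists_countable_separating (A := (A : Set (E →ᵇ ℝ))) hA
  have := hSc.to_subtype
  -- The topology of `E` need not be Polish. The countable separating family maps `E` injectively
  -- into a countable product of compact intervals, which is Polish; an injective measurable map
  -- between standard Borel spaces is a measurable embedding, so it is enough to compare the image
  -- measures.
  let K := (f : S) → Set.Icc (-‖f.1‖) ‖f.1‖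
  have hPI : ∀ f : S, PolishSpace (Set.Icc (-‖f.1‖) ‖f.1‖) := fun f => isClosed_Icc.polishSpace
  let G : C(E, K) := ⟨fun x f => ⟨f.1 x, abs_le.1 (f.1.norm_coe_le_norm x)⟩,
    continuous_pi fun f => f.1.continuous.subtype_mk _⟩
  have hGi : Function.Injective G := by
    intro x y hxy
    by_contra hne
    obtain ⟨f, hf, hfne⟩ := hS x y hne
    exact hfne (congrArg Subtype.val (congrFun hxy ⟨f, hf⟩))
  have hG : MeasurableEmbedding G := G.continuous.measurable.measurableEmbedding hGi
  -- The functions on `K` that pull back into `A`. They contain the coordinate functions of `K`,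
  -- hence separate its points.
  let B : StarSubalgebra ℝ (K →ᵇ ℝ) :=
    { carrier := {p | p.compContinuous G ∈ A}
      mul_mem' := fun ha hb => A.mul_mem ha hb
      add_mem' := fun ha hb => A.add_mem ha hb
      algebraMap_mem' := fun c => A.algebraMap_mem c
      star_mem' := fun ha => ha }
  have hB : (B.map (BoundedContinuousFunction.toContinuousMapStarₐ ℝ)).SeparatesPoints := by
    intro x y hxy
    obtain ⟨f, hf⟩ := Function.ne_iff.1 hxy
    let p : K →ᵇ ℝ := BoundedContinuousFunction.mkOfCompact
      ⟨fun k => (k f : ℝ), continuous_subtype_val.comp (continuous_apply f)⟩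
    have hp : p ∈ B := by
      change p.compContinuous G ∈ A
      have : p.compContinuous G = f.1 := by ext x; rfl
      rw [this]
      exact hSA f.2
    exact ⟨_, ⟨_, ⟨p, hp, rfl⟩, rfl⟩, fun he => hf (Subtype.ext he)⟩
  have key : μ.map G = ν.map G := by
    refine ext_of_forall_mem_subalgebra_integral_eq_of_polish hB fun g hg => ?_
    rw [hG.integral_map, hG.integral_map]
    exact h _ hg
  rw [← hG.comap_map μ, key, hG.comap_map]

theorem probabilityMeasure_ext_of_subalgebra [SecondCountableTopology E] [BorelSpace E]
    [StandardBorelSpace E] {μ ν : ProbabilityMeasure E}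
    (A : Subalgebra ℝ (E →ᵇ ℝ)) (hA : ∀ x y, x ≠ y → ∃ f ∈ A, f x ≠ f y)
    (h : ∀ f ∈ A, ∫ x, f x ∂(μ : Measure E) = ∫ x, f x ∂(ν : Measure E)) : μ = ν :=
  Subtype.ext (measure_ext_of_subalgebra (μ := (μ : Measure E)) (ν := (ν : Measure E)) A hA h)

/-- The Bochner integral of a bounded continuous function is continuous in the measure, for the
weak topology on probability measures and the norm topology on the target. -/
theorem continuous_integral_of_bounded [SecondCountableTopology E] [OpensMeasurableSpace E]
    {F : Type*} [NormedAddCommGroup F] [NormedSpace ℝ F] [CompleteSpace F]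
    {f : E → F} (hf : Continuous f) {M : ℝ} (hM : ∀ x, ‖f x‖ ≤ M) :
    Continuous fun μ : ProbabilityMeasure E => ∫ x, f x ∂(μ : Measure E) := by
  refine continuous_iff_continuousAt.2 fun μ => Metric.tendsto_nhds.2 fun ε hε => ?_
  have : Nonempty E := nonempty_of_isProbabilityMeasure (μ : Measure E)
  have hM0 : 0 ≤ M := (norm_nonneg _).trans (hM (Classical.arbitrary E))
  let v : ℕ → F := fun n => f (denseSeq E n)
  -- The final estimate consists of two approximation errors of at most `η + M * η` and one error
  -- below `η`.
  obtain ⟨η, hη, hηε⟩ : ∃ η > 0, η * (3 + 2 * M) < ε :=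
    ⟨ε / (2 * (3 + 2 * M)), by positivity, by
      rw [div_mul_eq_mul_div, div_lt_iff₀ (by positivity)]; nlinarith⟩
  -- Partition of unity: `θ N n` lives where `f` is `η`-close to `v n`, and `q N` is the mass not
  -- covered by the first `N` bumps. The term `δ N` keeps the denominators positive. Thus `f` is
  -- close to a finite sum of scalar functions times vectors, up to `η + M * q N`.
  let ψ : ℕ → E → ℝ := fun n x => max 0 (η - ‖f x - v n‖)
  let s : ℕ → E → ℝ := fun N x => ∑ n ∈ Finset.range N, ψ n x
  let δ : ℕ → ℝ := fun N => 1 / ((N : ℝ) + 1)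
  have hψ0 : ∀ n x, 0 ≤ ψ n x := fun n x => le_max_left _ _
  have hs0 : ∀ N x, 0 ≤ s N x := fun N x => Finset.sum_nonneg fun n _ => hψ0 n x
  have hδ : ∀ N, 0 < δ N := fun N => Nat.one_div_pos_of_nat
  have hden : ∀ N x, 0 < δ N + s N x := fun N x => add_pos_of_pos_of_nonneg (hδ N) (hs0 N x)
  have hψc : ∀ n, Continuous (ψ n) := fun n => by fun_prop
  have hsc : ∀ N, Continuous (s N) := fun N => continuous_finsetSum _ fun n _ => hψc n
  let q : ℕ → E →ᵇ ℝ := fun N => BoundedContinuousFunction.ofNormedAddCommGroup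
    (fun x => δ N / (δ N + s N x))
    (continuous_const.div (continuous_const.add (hsc N)) fun x => (hden N x).ne') 1 fun x => by
      rw [Real.norm_of_nonneg (div_nonneg (hδ N).le (hden N x).le)]
      exact div_le_one_of_le₀ (by linarith [hs0 N x]) (hden N x).le
  let θ : ℕ → ℕ → E →ᵇ ℝ := fun N n => BoundedContinuousFunction.ofNormedAddCommGroup
    (fun x => ψ n x / (δ N + s N x))
    ((hψc n).div (continuous_const.add (hsc N)) fun x => (hden N x).ne') (η / δ N) fun x => by
      rw [Real.norm_of_nonneg (div_nonneg (hψ0 n x) (hden N x).le)]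
      refine div_le_div₀ hη.le (max_le hη.le (by linarith [norm_nonneg (f x - v n)])) (hδ N) ?_
      linarith [hs0 N x]
  have hq0 : ∀ N x, 0 ≤ q N x := fun N x => div_nonneg (hδ N).le (hden N x).le
  have hq1 : ∀ N x, q N x ≤ 1 := fun N x =>
    div_le_one_of_le₀ (by linarith [hs0 N x]) (hden N x).le
  have happrox : ∀ N x, ‖f x - ∑ n ∈ Finset.range N, θ N n x • v n‖ ≤ η + M * q N x := by
    intro N x
    have hsum : q N x + ∑ n ∈ Finset.range N, θ N n x = 1 := by
      change δ N / (δ N + s N x) + ∑ n ∈ Finset.range N, ψ n x / (δ N + s N x) = 1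
      rw [← Finset.sum_div, ← add_div, div_self (hden N x).ne']
    have e : f x - ∑ n ∈ Finset.range N, θ N n x • v n =
        q N x • f x + ∑ n ∈ Finset.range N, θ N n x • (f x - v n) := by
      simp only [smul_sub, Finset.sum_sub_distrib]
      rw [← Finset.sum_smul, ← add_sub_assoc, ← add_smul, hsum, one_smul]
    have hθ0 : ∀ n, 0 ≤ θ N n x := fun n => div_nonneg (hψ0 n x) (hden N x).le
    have hθ : ∀ n, ‖θ N n x • (f x - v n)‖ ≤ θ N n x * η := by
      intro n
      rw [norm_smul, Real.norm_of_nonneg (hθ0 n)]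
      by_cases hn : ‖f x - v n‖ ≤ η
      · exact mul_le_mul_of_nonneg_left hn (hθ0 n)
      · have : θ N n x = 0 := by
          change max 0 (η - ‖f x - v n‖) / _ = 0
          rw [max_eq_left (by linarith), zero_div]
        simp [this]
    rw [e]
    calc _ ≤ q N x * M + ∑ n ∈ Finset.range N, θ N n x * η := by
          refine (norm_add_le _ _).trans (add_le_add ?_ ((norm_sum_le _ _).trans
            (Finset.sum_le_sum fun n _ => hθ n)))
          rw [norm_smul, Real.norm_of_nonneg (hq0 N x)]
          exact mul_le_mul_of_nonneg_left (hM x) (hq0 N x)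
      _ ≤ η + M * q N x := by
          rw [← Finset.sum_mul]
          nlinarith [hq0 N x]
  -- The values `v n` are dense in the range of `f`, so every point meets some bump and `q N` tends
  -- to `0` there.
  have hqlim : Tendsto (fun N => ∫ x, q N x ∂(μ : Measure E)) atTop (𝓝 0) := by
    have h0 : ∫ _, (0 : ℝ) ∂(μ : Measure E) = 0 := by simp
    rw [← h0]
    refine tendsto_integral_of_dominated_convergence (fun _ => 1)
      (fun N => (q N).continuous.aestronglyMeasurable) (integrable_const _)
      (fun N => ae_of_all _ fun x => ?_) (ae_of_all _ fun x => ?_)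
    · rw [Real.norm_of_nonneg (hq0 N x)]
      exact hq1 N x
    · obtain ⟨n, hn⟩ : ∃ n, ‖f x - v n‖ < η := by
        have ho : IsOpen {y | ‖f x - f y‖ < η} := isOpen_lt (by fun_prop) continuous_const
        exact (denseRange_denseSeq E).exists_mem_open ho ⟨x, by simpa using hη⟩
      have hpos : 0 < ψ n x := lt_max_of_lt_right (by linarith)
      refine squeeze_zero' (Eventually.of_forall fun N => hq0 N x)
        (eventually_atTop.2 ⟨n + 1, fun N hN => ?_⟩)
        (g := fun N => δ N / ψ n x) ?_
      · refine div_le_div_of_nonneg_left (hδ N).le hpos ?_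
        have : ψ n x ≤ s N x := Finset.single_le_sum (f := fun n => ψ n x)
          (fun i _ => hψ0 i x) (Finset.mem_range.2 (by omega))
        linarith [hδ N]
      · have := (tendsto_one_div_add_atTop_nhds_zero_nat (𝕜 := ℝ)).div_const (ψ n x)
        rwa [zero_div] at this
  obtain ⟨N, hN⟩ := (hqlim.eventually (gt_mem_nhds hη)).exists
  let g : E → F := fun x => ∑ n ∈ Finset.range N, θ N n x • v n
  have hint : ∀ ρ : ProbabilityMeasure E, Integrable f (ρ : Measure E) := fun ρ =>
    Integrable.of_bound hf.aestronglyMeasurable M (ae_of_all _ hM)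
  have hgt : ∀ (ρ : ProbabilityMeasure E) n, n ∈ Finset.range N →
      Integrable (fun x => θ N n x • v n) (ρ : Measure E) :=
    fun ρ n _ => ((θ N n).integrable _).smul_const _
  have hgint : ∀ ρ : ProbabilityMeasure E, Integrable g (ρ : Measure E) := fun ρ =>
    integrable_finsetSum _ (hgt ρ)
  have hgc : Continuous fun ρ : ProbabilityMeasure E => ∫ x, g x ∂(ρ : Measure E) := by
    have : (fun ρ : ProbabilityMeasure E => ∫ x, g x ∂(ρ : Measure E)) =
        fun ρ : ProbabilityMeasure E => ∑ n ∈ Finset.range N, (∫ x, θ N n x ∂(ρ : Measure E)) • v n := by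
      funext ρ
      rw [integral_finsetSum _ (hgt ρ)]
      simp only [integral_smul_const]
    rw [this]
    exact continuous_finsetSum _ fun n _ =>
      (ProbabilityMeasure.continuous_integral_boundedContinuousFunction (θ N n)).smul
        continuous_const
  have hfg : ∀ ρ : ProbabilityMeasure E, ‖∫ x, f x ∂(ρ : Measure E) - ∫ x, g x ∂(ρ : Measure E)‖ ≤
      η + M * ∫ x, q N x ∂(ρ : Measure E) := by
    intro ρ
    rw [← integral_sub (hint ρ) (hgint ρ)]
    refine (norm_integral_le_of_norm_le (((integrable_const η)).add
      (((q N).integrable _).const_mul M)) (ae_of_all _ (happrox N))).trans (le_of_eq ?_)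
    rw [integral_add' (integrable_const η) (((q N).integrable _).const_mul M),
      integral_const_mul]
    simp
  -- `q N` is itself bounded and continuous, so its integral stays small for all measures near `μ`:
  -- no tightness argument is needed.
  have h1 := (ProbabilityMeasure.continuous_integral_boundedContinuousFunction
    (q N)).continuousAt (x := μ) |>.eventually (gt_mem_nhds hN)
  have h2 := Metric.tendsto_nhds.1 (hgc.continuousAt (x := μ)) η hη
  filter_upwards [h1, h2] with ρ h1 h2
  have h3 := hfg ρ
  have h4 := hfg μ
  rw [dist_eq_norm] at h2 ⊢
  have h5 : M * ∫ x, q N x ∂(ρ : Measure E) ≤ M * η := by gcongr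
  have h6 : M * ∫ x, q N x ∂(μ : Measure E) ≤ M * η := by gcongr
  set a := ∫ x, f x ∂(ρ : Measure E)
  set b := ∫ x, g x ∂(ρ : Measure E)
  set c := ∫ x, f x ∂(μ : Measure E)
  set d := ∫ x, g x ∂(μ : Measure E)
  calc ‖a - c‖ = ‖(a - b) + (b - d) - (c - d)‖ := by congr 1; abel
    _ ≤ ‖a - b‖ + ‖b - d‖ + ‖c - d‖ :=
      (norm_sub_le _ _).trans (add_le_add (norm_add_le _ _) le_rfl)
    _ < ε := by nlinarith

end WeakTopology

/-! ### Conditional laws and prediction processes. -/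

theorem condDistrib_map_ae_eq_dirac {Ω Ω' S S' : Type*} [MeasurableSpace Ω] [MeasurableSpace Ω']
    [MeasurableSpace S] [StandardBorelSpace S] [Nonempty S]
    [MeasurableSpace S'] [StandardBorelSpace S'] [Nonempty S']
    {P : Measure Ω} [IsFiniteMeasure P] {Y : Ω → S} (hY : Measurable Y) {Z : Ω → Ω'}
    (hZ : Measurable Z) {f : S → S'} (hf : Measurable f) {h : Ω' → S'} (hh : Measurable h)
    (hfh : f ∘ Y = h ∘ Z) :
    ∀ᵐ ω ∂P, (condDistrib Y Z P (Z ω)).map f = Measure.dirac (h (Z ω)) := by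
  have h1 := ae_of_ae_map hZ.aemeasurable (condDistrib_comp (μ := P) Z hY.aemeasurable hf)
  rw [hfh] at h1
  have h2 := ae_of_ae_map hZ.aemeasurable (condDistrib_comp_self (μ := P) Z hh)
  filter_upwards [h1, h2] with ω h1 h2
  rw [h1, Kernel.map_apply _ hf, Kernel.deterministic_apply] at h2
  exact h2

namespace AdaptedProcess

variable {T : ℕ} {E E' : State.{u}}

/-- Adaptedness: `X_t` is known given `ℱ_t`, so its conditional law is a point mass. This is what
makes `X` recoverable from its prediction process. -/
theorem condLaw_map_ae_eq_dirac (X : AdaptedProcess.{u, w} T E) (t : Fin (T + 1)) :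
    ∀ᵐ ω ∂X.P, (X.condLaw t ω).map (fun x => x t) = Measure.dirac (X.X t ω) := by
  have := X.nonempty_path
  have : Nonempty E := this.map fun x => x t
  -- Conditioning on `ℱ_t` is conditioning on the identity map into the sample space equipped with
  -- `ℱ_t`.
  exact @condDistrib_map_ae_eq_dirac X.Ω X.Ω (Fin (T + 1) → E) E _ (X.ℱ t) _ _ _ _ _ _ X.P _ X.path
    X.measurable_path id (measurable_id'' (X.ℱ.le t)) (fun x => x t) (measurable_pi_apply t)
    (X.X t) (X.adapted t) rfl

theorem condExp_ae_eq_integral_condLaw (X : AdaptedProcess.{u, w} T E) (t : Fin (T + 1))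
    (f : (Fin (T + 1) → E) →ᵇ ℝ) :
    X.P[fun ω => f (X.path ω) | X.ℱ t] =ᵐ[X.P] fun ω => ∫ x, f x ∂(X.condLaw t ω) := by
  have := X.nonempty_path
  have h := condExp_ae_eq_integral_condDistrib (μ := X.P) (X := id) (Y := X.path) (mβ := X.ℱ t)
    (measurable_id'' (X.ℱ.le t)) X.measurable_path.aemeasurable (f := f)
    f.continuous.stronglyMeasurable
    (Integrable.of_bound (f.continuous.measurable.comp X.measurable_path).aestronglyMeasurable
      ‖f‖ (ae_of_all _ fun ω => f.norm_coe_le_norm _))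
  rw [MeasurableSpace.comap_id] at h
  exact h

/-- The filtered probability space of `X` with another adapted process on it. -/
def replace (X : AdaptedProcess.{u, w} T E) (Y : Fin (T + 1) → X.Ω → E')
    (hY : ∀ t, Measurable[X.ℱ t] (Y t)) : AdaptedProcess.{u, w} T E' :=
  { Ω := X.Ω, P := X.P, ℱ := X.ℱ, X := Y, adapted := hY }

/-- The rank `r` prediction process as a process on the sample space of `X`. -/
def prediction (X : AdaptedProcess.{u, w} T E) : (r : ℕ) →
    {Y : Fin (T + 1) → X.Ω → rankProb T E r // ∀ t, Measurable[X.ℱ t] (Y t)}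
  | 0 => ⟨X.X, X.adapted⟩
  | r + 1 =>
    let Z := (X.replace (X.prediction r).1 (X.prediction r).2).predict
    ⟨Z.X, Z.adapted⟩

/-- The sample space of `X.predictRank r` is that of `X` only after induction on `r`. Keeping all
ranks on `X.Ω` gives meaning to almost sure identities between processes of different ranks. -/
theorem predictRank_eq_replace (X : AdaptedProcess.{u, w} T E) (r : ℕ) :
    X.predictRank r = X.replace (X.prediction r).1 (X.prediction r).2 := by
  induction r with
  | zero => rfl
  | succ r ih =>
    change (X.predictRank r).predict = _
    rw [ih]
    rfl

/-- The path of the rank `r` prediction process. -/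
def predictionPath (X : AdaptedProcess.{u, w} T E) (r : ℕ) (ω : X.Ω) :
    Fin (T + 1) → rankProb T E r := fun t => (X.prediction r).1 t ω

theorem measurable_predictionPath (X : AdaptedProcess.{u, w} T E) (r : ℕ) :
    Measurable (X.predictionPath r) :=
  (X.replace (X.prediction r).1 (X.prediction r).2).measurable_path

/-- The law of the rank `r` prediction process. -/
def predictionLaw (r : ℕ) (X : AdaptedProcess.{u, w} T E) :
    ProbabilityMeasure (Fin (T + 1) → rankProb T E r) :=
  (X.predictRank r).law

theorem integral_predictionLaw (X : AdaptedProcess.{u, w} T E) (r : ℕ)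
    (f : (Fin (T + 1) → rankProb T E r) →ᵇ ℝ) :
    ∫ x, f x ∂(X.predictionLaw r : Measure (Fin (T + 1) → rankProb T E r)) =
      ∫ ω, f (X.predictionPath r ω) ∂X.P := by
  rw [predictionLaw, predictRank_eq_replace]
  exact integral_map (X.measurable_predictionPath r).aemeasurable
    f.continuous.aestronglyMeasurable

theorem integral_predictRank (X : AdaptedProcess.{u, w} T E) (r : ℕ)
    (f : (Fin (T + 1) → rankProb T E r) →ᵇ ℝ) :
    ∫ ω, f ((X.predictRank r).path ω) ∂(X.predictRank r).P =
      ∫ x, f x ∂(X.predictionLaw r : Measure (Fin (T + 1) → rankProb T E r)) :=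
  (integral_map (X.predictRank r).measurable_path.aemeasurable
    f.continuous.aestronglyMeasurable).symm

end AdaptedProcess

/-! ### Continuous functions lifted from one rank to the next. -/

section Lifts

variable {T : ℕ} {E : State.{u}}

/-- Integration of a bounded continuous function on paths against the `t`-th measure. -/
def integralLift (t : Fin (T + 1)) (f : (Fin (T + 1) → E) →ᵇ ℝ) :
    (Fin (T + 1) → E.probPath T) →ᵇ ℝ :=
  BoundedContinuousFunction.ofNormedAddCommGroup
    (fun μ => ∫ x, f x ∂((μ t : ProbabilityMeasure (Fin (T + 1) → E)) :
      Measure (Fin (T + 1) → E)))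
    ((ProbabilityMeasure.continuous_integral_boundedContinuousFunction f).comp
      (continuous_apply t)) ‖f‖ fun _ => f.norm_integral_le_norm _

/-- The product of the marginals at time `t` of the `t`-th measures. -/
def diagonalProduct (μ : Fin (T + 1) → ProbabilityMeasure (Fin (T + 1) → E)) :
    ProbabilityMeasure (Fin (T + 1) → E) :=
  ProbabilityMeasure.pi fun t => (μ t).map (f := fun x => x t) (measurable_pi_apply t).aemeasurable

theorem continuous_diagonalProduct :
    Continuous (diagonalProduct : (Fin (T + 1) → ProbabilityMeasure (Fin (T + 1) → E)) → _) :=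
  ProbabilityMeasure.continuous_pi.comp (continuous_pi fun t =>
    (ProbabilityMeasure.continuous_map (continuous_apply t)).comp (continuous_apply t))

/-- Integration of a bounded continuous function on paths against the product of the marginals. -/
def diagonalLift (f : (Fin (T + 1) → E) →ᵇ ℝ) : (Fin (T + 1) → E.probPath T) →ᵇ ℝ :=
  BoundedContinuousFunction.ofNormedAddCommGroup
    (fun μ => ∫ x, f x ∂(diagonalProduct μ : Measure (Fin (T + 1) → E)))
    ((ProbabilityMeasure.continuous_integral_boundedContinuousFunction f).comp
      continuous_diagonalProduct) ‖f‖ fun _ => f.norm_integral_le_norm _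

/-- Almost surely the time `t` marginal of the conditional law given `ℱ_t` is the point mass at
`X_t`, so the product of these marginals is the point mass at the whole path. The product is defined
and continuous for arbitrary families of measures, so `f(X)` becomes a continuous function of the
prediction process. -/
theorem AdaptedProcess.diagonalLift_predict (X : AdaptedProcess.{u, w} T E)
    (f : (Fin (T + 1) → E) →ᵇ ℝ) :
    (fun ω => f (X.path ω)) =ᵐ[X.P] fun ω => diagonalLift f (X.predict.path ω) := by
  filter_upwards [ae_all_iff.2 X.condLaw_map_ae_eq_dirac] with ω hω
  have h : (diagonalProduct (X.predict.path ω) : Measure (Fin (T + 1) → E)) =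
      Measure.dirac (X.path ω) := by
    change Measure.pi (fun t => (X.condLaw t ω).map fun x => x t) = _
    simp only [hω]
    refine Measure.pi_eq (μ := fun t => Measure.dirac (X.X t ω)) fun s hs => ?_
    rw [Measure.dirac_apply' _ (MeasurableSet.univ_pi hs), Finset.prod_congr rfl fun t _ =>
      Measure.dirac_apply' _ (hs t)]
    by_cases h : ∀ t, X.X t ω ∈ s t
    · rw [Set.indicator_of_mem (show X.path ω ∈ Set.univ.pi s from fun t _ => h t),
        Finset.prod_eq_one fun t _ => ?_]
      · rfl
      · exact Set.indicator_of_mem (h t) _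
    · rw [Set.indicator_of_notMem
        (show X.path ω ∉ Set.univ.pi s from fun h' => h fun t => h' t trivial)]
      obtain ⟨t, ht⟩ := not_forall.1 h
      exact (Finset.prod_eq_zero (Finset.mem_univ t) (Set.indicator_of_notMem ht _)).symm
  change _ = ∫ x, f x ∂(diagonalProduct (X.predict.path ω) : Measure (Fin (T + 1) → E))
  rw [h, integral_dirac]

/-- Composition of adapted functionals admits bounded outer functions only, while sums and products
are unbounded. Clamping the arguments to a box that contains all values removes the obstacle. -/
theorem exists_bounded_eq_on_box {n : ℕ} {k : (Fin n → ℝ) → ℝ} (hk : Continuous k) (R : ℝ) :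
    ∃ h : (Fin n → ℝ) →ᵇ ℝ, ∀ a, (∀ i, |a i| ≤ R) → h a = k a := by
  let c : (Fin n → ℝ) → Fin n → ℝ := fun a i => max (-|R|) (min |R| (a i))
  have hc : Continuous c := by fun_prop
  obtain ⟨C, hC⟩ := (isCompact_univ_pi fun _ : Fin n => isCompact_Icc (a := -|R|) (b := |R|))
    |>.exists_bound_of_continuousOn hk.continuousOn
  refine ⟨BoundedContinuousFunction.ofNormedAddCommGroup (k ∘ c) (hk.comp hc) C fun a =>
    hC _ fun i _ => ⟨le_max_left _ _, max_le (by linarith [abs_nonneg R]) (min_le_left _ _)⟩,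
    fun a ha => ?_⟩
  change k (c a) = k a
  congr 1
  funext i
  have h1 := abs_le.1 ((ha i).trans (le_abs_self R))
  simp only [c]
  rw [min_eq_right h1.2, max_eq_right h1.1]

end Lifts

/-! ### Adapted functionals as functions of the prediction process. -/

namespace AdaptedFunctional

variable {T : ℕ} {E : State.{u}}

/-- The adapted functional `f` is the function `g` of the rank `r` prediction process. -/
def Represents (f : AdaptedFunctional T E) (r : ℕ) (g : (Fin (T + 1) → rankProb T E r) →ᵇ ℝ) :
    Prop :=
  ∀ X : AdaptedProcess.{u, w} T E, f.eval X =ᵐ[X.P] fun ω => g (X.predictionPath r ω)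

theorem Represents.succ {f : AdaptedFunctional T E} {r : ℕ}
    {g : (Fin (T + 1) → rankProb T E r) →ᵇ ℝ} (h : Represents.{u, w} f r g) :
    Represents.{u, w} f (r + 1) (diagonalLift (E := rankProb T E r) g) := fun X =>
  (h X).trans ((X.replace (X.prediction r).1 (X.prediction r).2).diagonalLift_predict g)

/-- A conditional expectation given `ℱ_t` is an integral against the conditional law, that is,
against the next prediction process at time `t`. -/
theorem Represents.cond {f : AdaptedFunctional T E} {r : ℕ}
    {g : (Fin (T + 1) → rankProb T E r) →ᵇ ℝ} (h : Represents.{u, w} f r g) (t : Fin (T + 1)) :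
    Represents.{u, w} (f.cond t) (r + 1) (integralLift (E := rankProb T E r) t g) := fun X =>
  (condExp_congr_ae (h X)).trans
    ((X.replace (X.prediction r).1 (X.prediction r).2).condExp_ae_eq_integral_condLaw t g)

theorem Represents.comp {n r : ℕ} {f : Fin n → AdaptedFunctional T E}
    {g : Fin n → (Fin (T + 1) → rankProb T E r) →ᵇ ℝ} (h : ∀ i, Represents.{u, w} (f i) r (g i))
    (k : (Fin n → ℝ) →ᵇ ℝ) :
    Represents.{u, w} (.comp n f k) r
      (k.compContinuous ⟨fun x i => g i x, continuous_pi fun i => (g i).continuous⟩) := by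
  intro X
  filter_upwards [ae_all_iff.2 fun i => h i X] with ω hω
  change k (fun i => (f i).eval X ω) = k _
  simp only [hω]
  rfl

theorem exists_represents_base (n : ℕ) (t : Fin n → Fin (T + 1)) (f : (Fin n → E) →ᵇ ℝ) (r : ℕ) :
    ∃ g, Represents.{u, w} (.base n t f) r g := by
  induction r with
  | zero =>
    exact ⟨f.compContinuous ⟨fun (x : Fin (T + 1) → E) i => x (t i), by fun_prop⟩,
      fun X => Eventually.of_forall fun ω => rfl⟩
  | succ r ih =>
    obtain ⟨g, hg⟩ := ih
    exact ⟨_, hg.succ⟩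

/-- All `r` above the rank are treated at once, because the arguments of a `comp` may have different
ranks and need a common one. -/
theorem exists_represents (f : AdaptedFunctional T E) :
    ∀ r, f.rank ≤ r → ∃ g, Represents.{u, w} f r g := by
  induction f with
  | base n t f => exact fun r _ => exists_represents_base n t f r
  | comp n f k ih =>
    intro r hr
    have h : ∀ i, ∃ g, Represents.{u, w} (f i) r g := fun i =>
      ih i r ((Finset.le_sup (f := fun i => (f i).rank) (Finset.mem_univ i)).trans hr)
    choose g hg using h
    exact ⟨_, Represents.comp hg k⟩
  | cond f t ih =>
    intro r hr
    cases r with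
    | zero => exact absurd hr (Nat.not_succ_le_zero _)
    | succ r =>
      obtain ⟨g, hg⟩ := ih r (Nat.succ_le_succ_iff.1 hr)
      exact ⟨_, hg.cond t⟩

variable (T E) in
/-- The functions of the rank `r` prediction process that come from adapted functionals of rank at
most `r`. -/
def representable (r : ℕ) : Set ((Fin (T + 1) → rankProb T E r) →ᵇ ℝ) :=
  {g | ∃ f : AdaptedFunctional T E, f.rank ≤ r ∧ Represents.{u, w} f r g}

theorem comp_mem_representable {n r : ℕ} {g : Fin n → (Fin (T + 1) → rankProb T E r) →ᵇ ℝ}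
    (hg : ∀ i, g i ∈ representable.{u, w} T E r) {k : (Fin n → ℝ) → ℝ} (hk : Continuous k)
    {p : (Fin (T + 1) → rankProb T E r) →ᵇ ℝ} (hp : ∀ x, p x = k fun i => g i x) :
    p ∈ representable.{u, w} T E r := by
  choose f hr hf using hg
  obtain ⟨h, hh⟩ := exists_bounded_eq_on_box hk (∑ i, ‖g i‖)
  refine ⟨.comp n f h, Finset.sup_le fun i _ => hr i, ?_⟩
  have e : p = h.compContinuous ⟨fun x i => g i x, continuous_pi fun i => (g i).continuous⟩ := by
    ext x
    rw [hp]
    exact (hh _ fun i => ((g i).norm_coe_le_norm x).trans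
      (Finset.single_le_sum (f := fun i => ‖g i‖) (fun i _ => norm_nonneg _)
        (Finset.mem_univ i))).symm
  rw [e]
  exact Represents.comp hf h

variable (T E) in
/-- The functions that come from adapted functionals form an algebra. -/
def representableAlgebra (r : ℕ) : Subalgebra ℝ ((Fin (T + 1) → rankProb T E r) →ᵇ ℝ) where
  carrier := representable.{u, w} T E r
  mul_mem' {a b} ha hb := comp_mem_representable (g := ![a, b]) (k := fun v => v 0 * v 1)
    (by simp [Fin.forall_fin_two, ha, hb]) (by fun_prop) (by simp)
  add_mem' {a b} ha hb := comp_mem_representable (g := ![a, b]) (k := fun v => v 0 + v 1)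
    (by simp [Fin.forall_fin_two, ha, hb]) (by fun_prop) (by simp)
  algebraMap_mem' c := comp_mem_representable (n := 0) (g := Fin.elim0) (k := fun _ => c)
    (fun i => i.elim0) continuous_const (fun _ => by simp)

/-- Induction on the rank. At rank zero a truncated distance to one coordinate is enough. At rank `r
+ 1`, two paths differ in their measures at some time `t`; by the inductive hypothesis the algebra
of rank `r` determines measures, so some function in it has different integrals, and these integrals
come from conditional expectations given `ℱ_t`. -/
theorem representable_separates (r : ℕ) :
    ∀ x y, x ≠ y → ∃ f ∈ representableAlgebra.{u, w} T E r, f x ≠ f y := by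
  induction r with
  | zero =>
    intro x y hxy
    obtain ⟨t, ht⟩ := Function.ne_iff.1 hxy
    let _ := metrizableSpaceMetric E
    let x' : Fin (T + 1) → E := x
    let y' : Fin (T + 1) → E := y
    have ht' : x' t ≠ y' t := ht
    let p : (Fin 1 → E) →ᵇ ℝ := BoundedContinuousFunction.ofNormedAddCommGroup
      (fun z => min 1 (dist (z 0) (x' t))) (by fun_prop) 1 fun z => by
        rw [Real.norm_of_nonneg (le_min zero_le_one dist_nonneg)]
        exact min_le_left _ _
    refine ⟨p.compContinuous ⟨fun (x : Fin (T + 1) → E) _ => x t, by fun_prop⟩,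
      ⟨.base 1 (fun _ => t) p, le_rfl, fun X => Eventually.of_forall fun ω => rfl⟩, ?_⟩
    change min 1 (dist (x' t) (x' t)) ≠ min 1 (dist (y' t) (x' t))
    rw [dist_self, min_eq_right zero_le_one]
    exact (lt_min zero_lt_one (dist_pos.2 ht'.symm)).ne
  | succ r ih =>
    intro μ ν hne
    obtain ⟨t, ht⟩ := Function.ne_iff.1 hne
    by_contra! hcon
    refine ht ?_
    refine probabilityMeasure_ext_of_subalgebra (representableAlgebra.{u, w} T E r) ih ?_
    rintro g ⟨f, hfr, hf⟩
    exact hcon (integralLift (E := rankProb T E r) t g)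
      ⟨f.cond t, Nat.succ_le_succ hfr, hf.cond t⟩

end AdaptedFunctional

/-! ### The adapted and extended weak topologies as topologies on laws. -/

section Topologies

variable {T : ℕ} {E : State.{u}}

theorem extendedWeakTopology_eq_induced (r : ℕ) :
    extendedWeakTopology.{u, w} T E r =
      induced (AdaptedProcess.predictionLaw.{u, w} r) inferInstance := by
  rw [probabilityMeasure_topology_eq_iInf, induced_iInf]
  refine iInf_congr fun f => ?_
  rw [induced_compose]
  congr 1
  funext X
  exact X.integral_predictRank r f

variable (T E) in
/-- The topology on laws of prediction processes given by adapted functionals. -/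
abbrev functionalTopology (r : ℕ) :
    TopologicalSpace (ProbabilityMeasure (Fin (T + 1) → rankProb T E r)) :=
  ⨅ g : AdaptedFunctional.representableAlgebra.{u, w} T E r,
    induced (fun μ => ∫ x, g.1 x ∂(μ : Measure (Fin (T + 1) → rankProb T E r))) inferInstance

theorem le_functionalTopology (r : ℕ) :
    (inferInstance : TopologicalSpace (ProbabilityMeasure (Fin (T + 1) → rankProb T E r))) ≤
      functionalTopology.{u, w} T E r :=
  le_iInf fun g => continuous_iff_le_induced.1
    (ProbabilityMeasure.continuous_integral_boundedContinuousFunction g.1)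

theorem t2Space_functionalTopology (r : ℕ) : @T2Space _ (functionalTopology.{u, w} T E r) := by
  let := functionalTopology.{u, w} T E r
  refine ⟨fun μ ν hne => ?_⟩
  obtain ⟨g, hg, hgne⟩ : ∃ g ∈ AdaptedFunctional.representableAlgebra.{u, w} T E r,
      ∫ x, g x ∂(μ : Measure (Fin (T + 1) → rankProb T E r)) ≠
        ∫ x, g x ∂(ν : Measure (Fin (T + 1) → rankProb T E r)) := by
    by_contra! hcon
    exact hne (probabilityMeasure_ext_of_subalgebra _
      (AdaptedFunctional.representable_separates.{u, w} r) hcon)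
  have hc : Continuous fun μ : ProbabilityMeasure (Fin (T + 1) → rankProb T E r) =>
      ∫ x, g x ∂(μ : Measure (Fin (T + 1) → rankProb T E r)) :=
    continuous_iff_le_induced.2 (iInf_le
      (fun g : AdaptedFunctional.representableAlgebra.{u, w} T E r => induced
        (fun μ : ProbabilityMeasure (Fin (T + 1) → rankProb T E r) =>
          ∫ x, g.1 x ∂(μ : Measure (Fin (T + 1) → rankProb T E r))) inferInstance) ⟨g, hg⟩)
  exact separated_by_continuous hc hgne

/-- The representing function does not depend on the process, so the expectation of an adapted
functional is an integral against the prediction law. Every functional has such a function, and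
every function in the algebra has such a functional. -/
theorem adaptedTopology_eq_induced (r : ℕ) :
    adaptedTopology.{u, w} T E r =
      induced (AdaptedProcess.predictionLaw.{u, w} r) (functionalTopology.{u, w} T E r) := by
  have key : ∀ (f : AdaptedFunctional T E) (g : (Fin (T + 1) → rankProb T E r) →ᵇ ℝ),
      f.Represents.{u, w} r g →
      (fun X : AdaptedProcess.{u, w} T E => ∫ ω, f.eval X ω ∂X.P) =
        (fun μ : ProbabilityMeasure (Fin (T + 1) → rankProb T E r) =>
          ∫ x, g x ∂(μ : Measure (Fin (T + 1) → rankProb T E r))) ∘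
          AdaptedProcess.predictionLaw.{u, w} r := by
    intro f g h
    funext X
    exact (integral_congr_ae (h X)).trans (X.integral_predictionLaw r g).symm
  rw [functionalTopology, induced_iInf]
  refine le_antisymm (le_iInf fun g => ?_) (le_iInf fun f => ?_)
  · obtain ⟨g, f, hr, hf⟩ := g
    rw [induced_compose]
    refine (iInf_le _ ⟨f, hr⟩).trans (le_of_eq ?_)
    dsimp only
    rw [key f g hf]
  · obtain ⟨f, hr⟩ := f
    obtain ⟨g, hg⟩ := f.exists_represents.{u, w} r hr
    refine (iInf_le _ ⟨g, f, hr, hg⟩).trans (le_of_eq ?_)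
    rw [induced_compose]
    dsimp only
    rw [key f g hg]

end Topologies

/-! ### Tensor series with finite total norm: products and exponentials. -/

section Continuity

variable {F : Type u} [NormedAddCommGroup F] [NormedSpace ℝ F] (N : AdmissibleNorm F)

/-- The `ℓ¹`-norm of a tensor series. -/
def TensorSeries.total (s : TensorSeries F) : ℝ := ∑' m, N.nrm m (s m)

variable {N}

theorem TensorSeries.total_nonneg (s : TensorSeries F) : 0 ≤ s.total N :=
  tsum_nonneg fun _ => apply_nonneg _ _

theorem AdmissibleNorm.summable_add {s t : TensorSeries F}
    (hs : Summable fun m => N.nrm m (s m)) (ht : Summable fun m => N.nrm m (t m)) :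
    Summable fun m => N.nrm m ((s + t) m) :=
  Summable.of_nonneg_of_le (fun _ => apply_nonneg _ _) (fun m => map_add_le_add (N.nrm m) _ _)
    (hs.add ht)

theorem AdmissibleNorm.summable_sub {s t : TensorSeries F}
    (hs : Summable fun m => N.nrm m (s m)) (ht : Summable fun m => N.nrm m (t m)) :
    Summable fun m => N.nrm m ((s - t) m) :=
  Summable.of_nonneg_of_le (fun _ => apply_nonneg _ _) (fun m => map_sub_le_add (N.nrm m) _ _)
    (hs.add ht)

theorem TensorSeries.total_add_le {s t : TensorSeries F}
    (hs : Summable fun m => N.nrm m (s m)) (ht : Summable fun m => N.nrm m (t m)) :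
    (s + t).total N ≤ s.total N + t.total N := by
  rw [total, total, total, ← hs.tsum_add ht]
  exact (N.summable_add hs ht).tsum_le_tsum (fun m => map_add_le_add (N.nrm m) _ _) (hs.add ht)

theorem TensorSeries.total_mul_le {s t : TensorSeries F}
    (hs : Summable fun m => N.nrm m (s m)) (ht : Summable fun m => N.nrm m (t m)) :
    (s.mul t).total N ≤ s.total N * t.total N := by
  rw [total, total, total, tsum_mul_tsum_eq_tsum_sum_range_of_summable_norm hs.norm ht.norm]
  refine (N.summable_mul hs ht).tsum_le_tsum (fun m => ?_)
    (summable_norm_sum_mul_range_of_summable_norm hs.norm ht.norm).of_norm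
  rw [← Fin.sum_univ_eq_sum_range (fun i => N.nrm i (s i) * N.nrm (m - i) (t (m - i))) (m + 1)]
  refine (Finset.le_sum_of_subadditive (N.nrm m) (map_zero _).le (map_add_le_add _) _ _).trans
    (Finset.sum_le_sum fun i _ => ?_)
  rw [N.nrm_cast]
  exact N.nrm_mul_le _ _ _ _

/-- Telescoping, from which continuity of the product follows by submultiplicativity of `total`. -/
theorem TensorSeries.mul_sub_mul (s t s' t' : TensorSeries F) :
    s.mul t - s'.mul t' = (s - s').mul t + s'.mul (t - t') := by
  funext m
  simp only [TensorSeries.mul, Pi.sub_apply, Pi.add_apply, TensorProduct.sub_tmul,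
    TensorProduct.tmul_sub, map_sub, Finset.sum_sub_distrib]
  abel

variable (N) in
/-- A family of absolutely summable tensor series that depends continuously on a parameter. -/
structure ContinuousSeries {X : Type*} [TopologicalSpace X] (s : X → TensorSeries F) : Prop where
  summable : ∀ x, Summable fun m => N.nrm m (s x m)
  tendsto : ∀ x₀, Tendsto (fun x => (s x - s x₀).total N) (𝓝 x₀) (𝓝 0)

namespace ContinuousSeries

variable {X : Type*} [TopologicalSpace X] {s t : X → TensorSeries F}

theorem const {s : TensorSeries F} (hs : Summable fun m => N.nrm m (s m)) :
    ContinuousSeries N fun _ : X => s :=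
  ⟨fun _ => hs, fun _ => by simp [TensorSeries.total]⟩

theorem mul (hs : ContinuousSeries N s) (ht : ContinuousSeries N t) :
    ContinuousSeries N fun x => (s x).mul (t x) := by
  refine ⟨fun x => N.summable_mul (hs.summable x) (ht.summable x), fun x₀ => ?_⟩
  have hlim : Tendsto (fun x => (s x - s x₀).total N * ((t x - t x₀).total N + (t x₀).total N) +
      (s x₀).total N * (t x - t x₀).total N) (𝓝 x₀) (𝓝 0) := by
    have := ((hs.tendsto x₀).mul ((ht.tendsto x₀).add_const ((t x₀).total N))).add
      ((ht.tendsto x₀).const_mul ((s x₀).total N))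
    simpa using this
  refine squeeze_zero (fun x => TensorSeries.total_nonneg _) (fun x => ?_) hlim
  have hst := N.summable_sub (hs.summable x) (hs.summable x₀)
  have htt := N.summable_sub (ht.summable x) (ht.summable x₀)
  rw [TensorSeries.mul_sub_mul]
  refine (TensorSeries.total_add_le (N.summable_mul hst (ht.summable x))
    (N.summable_mul (hs.summable x₀) htt)).trans (add_le_add ?_
      (TensorSeries.total_mul_le (hs.summable x₀) htt))
  refine (TensorSeries.total_mul_le hst (ht.summable x)).trans
    (mul_le_mul_of_nonneg_left ?_ (TensorSeries.total_nonneg _))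
  have := TensorSeries.total_add_le htt (ht.summable x₀)
  rwa [sub_add_cancel] at this

theorem listProd (l : List (X → TensorSeries F)) (hl : ∀ s ∈ l, ContinuousSeries N s) :
    ContinuousSeries N fun x => TensorSeries.listProd (l.map fun s => s x) := by
  induction l with
  | nil => exact const N.summable_one
  | cons a l ih =>
    exact (hl a (by simp)).mul (ih fun s hs => hl s (by simp [hs]))

theorem continuous_toAlg (hs : ContinuousSeries N s) :
    Continuous fun x => (s x).toAlg N (hs.summable x) := by
  refine continuous_iff_continuousAt.2 fun x₀ => tendsto_iff_norm_sub_tendsto_zero.2 ?_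
  refine (hs.tendsto x₀).congr fun x => ?_
  rw [lp.norm_eq_tsum_rpow (by simp)]
  simp only [ENNReal.toReal_one, Real.rpow_one, div_one]
  refine tsum_congr fun m => ?_
  rw [← norm_toCompletion]
  congr 1
  exact UniformSpace.Completion.coe_sub (α := NormedPower N m) (s x m) (s x₀ m)

end ContinuousSeries

theorem tprod_const_succ (v : F) (m : ℕ) :
    (PiTensorProduct.tprod ℝ fun _ : Fin (m + 1) => v) =
      TensorPower.mulEquiv ((PiTensorProduct.tprod ℝ fun _ : Fin m => v) ⊗ₜ[ℝ]
        (PiTensorProduct.tprod ℝ fun _ : Fin 1 => v)) := by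
  rw [← TensorPower.gMul_def, TensorPower.tprod_mul_tprod]
  congr 1
  funext i
  refine Fin.addCases (fun j => ?_) (fun j => ?_) i <;> simp

theorem tprod_one_sub (v w : F) :
    (PiTensorProduct.tprod ℝ fun _ : Fin 1 => v) - (PiTensorProduct.tprod ℝ fun _ : Fin 1 => w) =
      PiTensorProduct.tprod ℝ fun _ : Fin 1 => v - w := by
  have h : ∀ v : F, (fun _ : Fin 1 => v) = Function.update (fun _ : Fin 1 => (0 : F)) 0 v :=
    fun v => funext fun i => by rw [Subsingleton.elim i 0, Function.update_self]
  rw [h, h w, h (v - w), MultilinearMap.map_update_sub]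

theorem tendsto_nrm_tprod_const (w : F) (m : ℕ) :
    Tendsto (fun v => N.nrm m ((PiTensorProduct.tprod ℝ fun _ => v) -
      PiTensorProduct.tprod ℝ fun _ => w)) (𝓝 w) (𝓝 0) := by
  induction m with
  | zero =>
    have : ∀ v : F, (fun _ : Fin 0 => v) = fun _ => w := fun v => funext fun i => i.elim0
    simp [this]
  | succ m ih =>
    have hlim : Tendsto (fun v => N.nrm m ((PiTensorProduct.tprod ℝ fun _ => v) -
        PiTensorProduct.tprod ℝ fun _ => w) * ‖v‖ + ‖w‖ ^ m * ‖v - w‖) (𝓝 w) (𝓝 0) := by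
      have h1 : Tendsto (fun v : F => ‖v‖) (𝓝 w) (𝓝 ‖w‖) := continuous_norm.tendsto w
      have h2 : Tendsto (fun v : F => ‖v - w‖) (𝓝 w) (𝓝 0) :=
        tendsto_iff_norm_sub_tendsto_zero.1 tendsto_id
      simpa using (ih.mul h1).add (h2.const_mul (‖w‖ ^ m))
    refine squeeze_zero (fun v => apply_nonneg _ _) (fun v => ?_) hlim
    -- Telescoping one factor at a time reduces the difference of powers to the previous power and
    -- to `v - w`.
    have e : ((PiTensorProduct.tprod ℝ fun _ : Fin (m + 1) => v) -
        PiTensorProduct.tprod ℝ fun _ : Fin (m + 1) => w) =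
        TensorPower.mulEquiv (((PiTensorProduct.tprod ℝ fun _ : Fin m => v) -
          PiTensorProduct.tprod ℝ fun _ : Fin m => w) ⊗ₜ[ℝ]
            (PiTensorProduct.tprod ℝ fun _ : Fin 1 => v)) +
        TensorPower.mulEquiv ((PiTensorProduct.tprod ℝ fun _ : Fin m => w) ⊗ₜ[ℝ]
          (PiTensorProduct.tprod ℝ fun _ : Fin 1 => v - w)) := by
      rw [tprod_const_succ v m, tprod_const_succ w m, ← tprod_one_sub, TensorProduct.sub_tmul,
        TensorProduct.tmul_sub, map_sub, map_sub]
      abel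
    rw [e]
    refine (map_add_le_add (N.nrm (m + 1)) _ _).trans (add_le_add ?_ ?_)
    · refine (N.nrm_mul_le _ _ _ _).trans (le_of_eq ?_)
      rw [N.nrm_one]
    · refine (N.nrm_mul_le _ _ _ _).trans ?_
      rw [N.nrm_one]
      gcongr
      exact N.nrm_tprod_const_le w m

theorem continuousSeries_exp : ContinuousSeries N (TensorSeries.exp : F → TensorSeries F) := by
  refine ⟨N.summable_exp, fun w => ?_⟩
  -- Dominating series on the ball where `‖v‖ < ‖w‖ + 1`; the factor `2` accounts for the two
  -- exponentials.
  have hb : Summable fun m => 2 * ((‖w‖ + 1) ^ m / m !) :=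
    (Real.summable_pow_div_factorial _).mul_left 2
  have h := tendsto_tsum_of_dominated_convergence (𝓕 := 𝓝 w)
    (f := fun (v : F) m => N.nrm m ((TensorSeries.exp v - TensorSeries.exp w) m))
    (g := fun _ => (0 : ℝ)) hb (fun m => ?_) ?_
  · rw [tsum_zero] at h
    exact h
  · have h1 := (tendsto_nrm_tprod_const (N := N) w m).const_mul ‖((m ! : ℝ)⁻¹)‖
    rw [mul_zero] at h1
    refine h1.congr fun v => ?_
    rw [← map_smul_eq_mul, smul_sub]
    rfl
  · have hball : ∀ᶠ v in 𝓝 w, ‖v‖ < ‖w‖ + 1 :=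
      continuous_norm.continuousAt.eventually (gt_mem_nhds (lt_add_one _))
    have hle : ∀ (v : F), ‖v‖ ≤ ‖w‖ + 1 → ∀ m,
        N.nrm m (TensorSeries.exp v m) ≤ (‖w‖ + 1) ^ m / m ! := by
      intro v hv m
      simp only [TensorSeries.exp, map_smul_eq_mul, norm_inv, RCLike.norm_natCast]
      rw [div_eq_inv_mul]
      gcongr
      exact (N.nrm_tprod_const_le v m).trans (by gcongr)
    filter_upwards [hball] with v hv m
    rw [Real.norm_of_nonneg (apply_nonneg _ _), two_mul]
    exact (map_sub_le_add (N.nrm m) _ _).trans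
      (add_le_add (hle v hv.le m) (hle w (by linarith) m))

theorem ContinuousSeries.comp {X Y : Type*} [TopologicalSpace X] [TopologicalSpace Y]
    {s : X → TensorSeries F} (hs : ContinuousSeries N s) {f : Y → X} (hf : Continuous f) :
    ContinuousSeries N fun y => s (f y) :=
  ⟨fun _ => hs.summable _, fun y₀ => (hs.tendsto (f y₀)).comp (hf.tendsto y₀)⟩

theorem TensorSeries.listProd_exp_zero (l : List F) :
    TensorSeries.listProd (l.map TensorSeries.exp) 0 = PiTensorProduct.tprod ℝ Fin.elim0 := by
  induction l with
  | nil => rfl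
  | cons v l ih =>
    change TensorSeries.mul _ (TensorSeries.listProd (l.map TensorSeries.exp)) 0 = _
    have h : TensorSeries.exp v 0 = PiTensorProduct.tprod ℝ Fin.elim0 := by
      simp only [TensorSeries.exp, Nat.factorial_zero, Nat.cast_one, inv_one, one_smul]
      congr 1
      exact funext fun i => i.elim0
    refine (Fintype.sum_subsingleton (ι := Fin 1) _ 0).trans ?_
    change TensorPower.cast ℝ _ _ (TensorPower.mulEquiv (TensorSeries.exp v 0 ⊗ₜ[ℝ]
      TensorSeries.listProd (l.map TensorSeries.exp) 0)) = _
    rw [h, ih, ← TensorPower.gMul_def, TensorPower.tprod_mul_tprod, TensorPower.cast_tprod]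
    congr 1
    exact funext fun i => i.elim0

end Continuity

/-! ### Continuity of the signature. -/

section Signature

variable {E : Type u} [NormedAddCommGroup E] [NormedSpace ℝ E] {T : ℕ}

theorem continuous_increment (t : Fin (T + 1)) :
    Continuous fun x : Fin (T + 1) → E => increment x t := by
  refine (WithLp.prod_continuous_toLp 1 ℝ E).comp (continuous_const.prodMk ?_)
  refine Fin.cases ?_ (fun s => ?_) t
  · exact continuous_apply 0
  · exact (continuous_apply _).sub (continuous_apply _)

theorem signatureSeries_eq (x : Fin (T + 1) → E) :
    signatureSeries x = TensorSeries.listProd ((List.ofFn (increment x)).map TensorSeries.exp) := by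
  rw [List.map_ofFn]
  rfl

theorem continuous_signature (N : AdmissibleNorm (Aug E)) :
    Continuous fun x : Fin (T + 1) → E => signature N x := by
  have h : ContinuousSeries N fun x : Fin (T + 1) → E => signatureSeries x := by
    have := ContinuousSeries.listProd (N := N)
      (List.ofFn fun t => fun x : Fin (T + 1) → E => TensorSeries.exp (increment x t)) (by
        intro s hs
        obtain ⟨t, rfl⟩ := (List.mem_ofFn' _ _).1 hs
        exact continuousSeries_exp.comp (continuous_increment t))
    simp only [List.map_ofFn] at this
    exact this
  exact h.continuous_toAlg

theorem signature_mem_unitTensors (N : AdmissibleNorm (Aug E)) (x : Fin (T + 1) → E) :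
    signature N x ∈ unitTensors N := by
  change toCompletion N (signatureSeries x 0) = _
  rw [signatureSeries_eq, TensorSeries.listProd_exp_zero]

end Signature

/-! ### Development of tensor series in an algebra. -/

section Development

variable {F : Type u} [NormedAddCommGroup F] [NormedSpace ℝ F]
variable {A : Type*} [Ring A] [Algebra ℝ A]

/-- The linear map `v_1 ⊗ ⋯ ⊗ v_m ↦ L v_1 ⋯ L v_m`. -/
def tensorDev (L : F →ₗ[ℝ] A) (m : ℕ) : (⨂[ℝ]^m F) →ₗ[ℝ] A :=
  (TensorAlgebra.lift ℝ L).toLinearMap ∘ₗ TensorPower.toTensorAlgebra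

theorem tensorDev_tprod (L : F →ₗ[ℝ] A) {m : ℕ} (v : Fin m → F) :
    tensorDev L m (PiTensorProduct.tprod ℝ v) = (List.ofFn fun i => L (v i)).prod := by
  simp [tensorDev, map_list_prod, List.map_ofFn, Function.comp_def]

theorem tensorDev_tprod_const (L : F →ₗ[ℝ] A) (m : ℕ) (v : F) :
    tensorDev L m (PiTensorProduct.tprod ℝ fun _ => v) = L v ^ m := by
  rw [tensorDev_tprod, List.ofFn_const, List.prod_replicate]

theorem tensorDev_mulEquiv (L : F →ₗ[ℝ] A) {m n : ℕ} (a : ⨂[ℝ]^m F) (b : ⨂[ℝ]^n F) :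
    tensorDev L (m + n) (TensorPower.mulEquiv (a ⊗ₜ[ℝ] b)) = tensorDev L m a * tensorDev L n b := by
  rw [← TensorPower.gMul_def]
  simp [tensorDev]

theorem tensorDev_cast (L : F →ₗ[ℝ] A) {m n : ℕ} (h : m = n) (u : ⨂[ℝ]^m F) :
    tensorDev L n (TensorPower.cast ℝ F h u) = tensorDev L m u := by
  subst h
  simp

theorem tensorDev_comp {B : Type*} [Ring B] [Algebra ℝ B] (α : A →ₐ[ℝ] B) (L : F →ₗ[ℝ] A) (m : ℕ)
    (u : ⨂[ℝ]^m F) : tensorDev (α.toLinearMap ∘ₗ L) m u = α (tensorDev L m u) := by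
  have h : TensorAlgebra.lift ℝ (α.toLinearMap ∘ₗ L) = α.comp (TensorAlgebra.lift ℝ L) := by
    ext v
    simp
  simp [tensorDev, h]

/-- The development `∑_m L^{⊗ m}(s_m) z^m` of a tensor series. -/
def devSeries (L : F →ₗ[ℝ] A) (s : TensorSeries F) : PowerSeries A :=
  PowerSeries.mk fun m => tensorDev L m (s m)

theorem devSeries_one (L : F →ₗ[ℝ] A) : devSeries L TensorSeries.one = 1 := by
  ext m
  rw [devSeries, PowerSeries.coeff_mk, PowerSeries.coeff_one]
  cases m with
  | zero => simp [TensorSeries.one, tensorDev_tprod]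
  | succ m => simp [TensorSeries.one]

/-- The formal variable records the tensor level, so multiplicativity holds coefficientwise and no
convergence is involved. -/
theorem devSeries_mul (L : F →ₗ[ℝ] A) (s t : TensorSeries F) :
    devSeries L (s.mul t) = devSeries L s * devSeries L t := by
  ext m
  rw [PowerSeries.coeff_mul, Finset.Nat.sum_antidiagonal_eq_sum_range_succ_mk, Finset.sum_range]
  simp only [devSeries, PowerSeries.coeff_mk, TensorSeries.mul, map_sum, tensorDev_cast,
    tensorDev_mulEquiv]

/-- The formal exponential `∑_m a^m z^m / m!`. -/
def expSeries (a : A) : PowerSeries A := PowerSeries.mk fun m => (m ! : ℝ)⁻¹ • a ^ m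

theorem devSeries_exp (L : F →ₗ[ℝ] A) (v : F) :
    devSeries L (TensorSeries.exp v) = expSeries (L v) := by
  ext m
  simp only [devSeries, expSeries, PowerSeries.coeff_mk, TensorSeries.exp, map_smul,
    tensorDev_tprod_const]

theorem devSeries_listProd (L : F →ₗ[ℝ] A) (l : List F) :
    devSeries L (TensorSeries.listProd (l.map TensorSeries.exp)) =
      (l.map fun v => expSeries (L v)).prod := by
  induction l with
  | nil => exact devSeries_one L
  | cons v l ih =>
    change devSeries L (TensorSeries.mul _ (TensorSeries.listProd (l.map TensorSeries.exp))) = _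
    rw [devSeries_mul, ih, devSeries_exp, List.map_cons, List.prod_cons]

/-- The binomial theorem for commuting elements, divided by factorials. -/
theorem expSeries_add {a b : A} (h : Commute a b) :
    expSeries (a + b) = expSeries a * expSeries b := by
  ext m
  rw [PowerSeries.coeff_mul]
  simp only [expSeries, PowerSeries.coeff_mk]
  rw [h.add_pow', Finset.smul_sum]
  refine Finset.sum_congr rfl fun p hp => ?_
  obtain rfl := Finset.HasAntidiagonal.mem_antidiagonal.1 hp
  rw [smul_mul_smul_comm, ← Nat.cast_smul_eq_nsmul ℝ, smul_smul]
  congr 1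
  have h1 : ((p.1 + p.2)! : ℝ) ≠ 0 := by positivity
  have h2 : (p.1 ! : ℝ) ≠ 0 := by positivity
  have h3 : (p.2 ! : ℝ) ≠ 0 := by positivity
  field_simp
  rw [← Nat.add_choose_mul_factorial_mul_factorial p.1 p.2, Nat.choose_symm_add]
  push_cast
  ring

theorem commute_expSeries {a b : A} (h : Commute a b) : Commute (expSeries a) (expSeries b) := by
  rw [Commute, SemiconjBy, ← expSeries_add h, add_comm, expSeries_add h.symm]

/-- Each exponential of a sum splits, and the factors from `L'` move past those from `L`. Applied to
commuting matrix representations, this plays the role of the shuffle identity for signatures. -/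
theorem devSeries_add {L L' : F →ₗ[ℝ] A} (h : ∀ v w, Commute (L v) (L' w)) (l : List F) :
    devSeries (L + L') (TensorSeries.listProd (l.map TensorSeries.exp)) =
      devSeries L (TensorSeries.listProd (l.map TensorSeries.exp)) *
        devSeries L' (TensorSeries.listProd (l.map TensorSeries.exp)) := by
  simp only [devSeries_listProd]
  induction l with
  | nil => simp
  | cons v l ih =>
    have hc : Commute (expSeries (L' v)) (l.map fun v => expSeries (L v)).prod := by
      refine Commute.list_prod_right _ _ fun x hx => ?_
      obtain ⟨w, _, rfl⟩ := List.mem_map.1 hx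
      exact (commute_expSeries (h w v)).symm
    rw [List.map_cons, List.prod_cons, List.map_cons, List.prod_cons, List.map_cons,
      List.prod_cons, LinearMap.add_apply, expSeries_add (h v v), ih, mul_assoc, mul_assoc,
      ← mul_assoc (expSeries (L' v)), hc.eq,
      mul_assoc]

end Development

/-! ### Matrix coordinates of signatures and their products. -/

section Coordinates

variable {F : Type u} [NormedAddCommGroup F] [NormedSpace ℝ F]

/-- The linear map to matrices with given continuous functionals as entries. -/
def matrixRep {ι : Type} (M : ι → ι → StrongDual ℝ F) : F →ₗ[ℝ] Matrix ι ι ℝ where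
  toFun v := Matrix.of fun i j => M i j v
  map_add' v w := by ext; simp
  map_smul' c v := by ext; simp

theorem matrixRep_apply {ι : Type} (M : ι → ι → StrongDual ℝ F) (v : F) (i j : ι) :
    matrixRep M v i j = M i j v := rfl

variable {ι κ : Type} [Fintype ι] [DecidableEq ι] [Fintype κ] [DecidableEq κ]

/-- Entries of products of matrices of functionals are sums of products of functionals. -/
theorem exists_entry_eq_sum (M : ι → ι → StrongDual ℝ F) (m : ℕ) :
    ∀ i j, ∃ (S : Type) (_ : Fintype S) (ℓ : S → Fin m → StrongDual ℝ F), ∀ v : Fin m → F,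
      (List.ofFn fun a => matrixRep M (v a)).prod i j = ∑ a, ∏ b, ℓ a b (v b) := by
  induction m with
  | zero =>
    intro i j
    by_cases h : i = j
    · exact ⟨Unit, inferInstance, fun _ => Fin.elim0, fun v => by simp [h]⟩
    · exact ⟨Empty, inferInstance, fun _ => Fin.elim0, fun v => by simp [h]⟩
  | succ m ih =>
    intro i j
    choose S hS ℓ hℓ using ih
    refine ⟨Σ k : ι, S k j, inferInstance, fun p => Fin.cons (M i p.1) (ℓ p.1 j p.2), fun v => ?_⟩
    rw [List.ofFn_succ, List.prod_cons, Matrix.mul_apply, Fintype.sum_sigma]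
    refine Finset.sum_congr rfl fun k _ => ?_
    rw [hℓ k j, Finset.mul_sum]
    simp [Fin.prod_univ_succ, matrixRep_apply]

/-- Admissibility of the norm controls tensor products of functionals; an entry of a product of
matrices of functionals is a finite sum of those. -/
theorem exists_bound_entry (N : AdmissibleNorm F) (M : ι → ι → StrongDual ℝ F) (m : ℕ) (i j : ι) :
    ∃ C : ℝ, ∀ u : ⨂[ℝ]^m F, |tensorDev (matrixRep M) m u i j| ≤ C * N.nrm m u := by
  obtain ⟨S, _, ℓ, hℓ⟩ := exists_entry_eq_sum M m i j
  choose C hC using fun a => N.functional_bound m (ℓ a)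
  refine ⟨∑ a, C a, fun u => ?_⟩
  have h : tensorDev (matrixRep M) m u i j =
      ∑ a, PiTensorProduct.lift ((MultilinearMap.mkPiAlgebra ℝ (Fin m) ℝ).compLinearMap
        fun b => (ℓ a b : F →ₗ[ℝ] ℝ)) u := by
    induction u using PiTensorProduct.induction_on with
    | smul_tprod c v =>
      rw [map_smul, tensorDev_tprod, Matrix.smul_apply, hℓ v, Finset.smul_sum]
      refine Finset.sum_congr rfl fun a _ => ?_
      rw [map_smul, PiTensorProduct.lift.tprod]
      simp
    | add u v hu hv => simp only [map_add, Matrix.add_apply, hu, hv, Finset.sum_add_distrib]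
  rw [h, Finset.sum_mul]
  exact (Finset.abs_sum_le_sum_abs _ _).trans (Finset.sum_le_sum fun a _ => hC a u)

/-- The graded version of a matrix of functionals, with levels up to `m`. -/
def unroll (M : ι → ι → StrongDual ℝ F) (m : ℕ) :
    ι × Fin (m + 1) → ι × Fin (m + 1) → StrongDual ℝ F :=
  fun p q => if (q.2 : ℕ) = p.2 + 1 then M p.1 q.1 else 0

/-- Every factor raises the level by exactly one. Entries from level `0` to level `m` therefore see
only tensors of degree `m`. -/
theorem prod_unroll (M : ι → ι → StrongDual ℝ F) (m : ℕ) (l : List F) (p q : ι × Fin (m + 1)) :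
    (l.map (matrixRep (unroll M m))).prod p q =
      if (q.2 : ℕ) = p.2 + l.length then (l.map (matrixRep M)).prod p.1 q.1 else 0 := by
  induction l generalizing p with
  | nil =>
    simp only [List.map_nil, List.prod_nil, List.length_nil, add_zero, Matrix.one_apply, Prod.ext_iff,
      Fin.ext_iff]
    by_cases h1 : p.1 = q.1 <;> by_cases h2 : (q.2 : ℕ) = p.2 <;> simp [h1, h2, eq_comm]
  | cons v l ih =>
    simp only [List.map_cons, List.prod_cons, Matrix.mul_apply, ih, matrixRep_apply, unroll]
    rw [Fintype.sum_prod_type]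
    split_ifs with h
    · refine Finset.sum_congr rfl fun k _ => ?_
      rw [List.length_cons] at h
      have hlt : (p.2 : ℕ) + 1 < m + 1 := by have := q.2.2; omega
      rw [Finset.sum_eq_single (⟨p.2 + 1, hlt⟩ : Fin (m + 1))]
      · rw [if_pos rfl, if_pos (by simp only; omega)]
      · intro c _ hc
        rw [if_neg fun hc' => hc (Fin.ext hc')]
        simp
      · simp
    · refine Finset.sum_eq_zero fun k _ => Finset.sum_eq_zero fun c _ => ?_
      rw [List.length_cons] at h
      by_cases hc : (c : ℕ) = p.2 + 1
      · rw [if_neg (c := (q.2 : ℕ) = c + l.length) (by omega), mul_zero]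
      · rw [if_neg hc]
        simp

theorem tensorDev_unroll (M : ι → ι → StrongDual ℝ F) (m k : ℕ) (u : ⨂[ℝ]^k F)
    (p q : ι × Fin (m + 1)) :
    tensorDev (matrixRep (unroll M m)) k u p q =
      if (q.2 : ℕ) = p.2 + k then tensorDev (matrixRep M) k u p.1 q.1 else 0 := by
  induction u using PiTensorProduct.induction_on with
  | smul_tprod c v =>
    have h := prod_unroll M m (List.ofFn v) p q
    rw [List.map_ofFn, List.map_ofFn, List.length_ofFn] at h
    rw [map_smul, map_smul, tensorDev_tprod, tensorDev_tprod, Matrix.smul_apply, Matrix.smul_apply]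
    simp only [Function.comp_def] at h
    rw [h, smul_ite, smul_zero]
  | add u v hu hv =>
    simp only [map_add, Matrix.add_apply, hu, hv]
    split_ifs <;> simp

open scoped Kronecker in
/-- The algebra homomorphism `a ↦ a ⊗ 1` on matrices. -/
def kroneckerLeft (ι κ : Type) [Fintype ι] [DecidableEq ι] [Fintype κ] [DecidableEq κ] :
    Matrix ι ι ℝ →ₐ[ℝ] Matrix (ι × κ) (ι × κ) ℝ :=
  AlgHom.ofLinearMap
    { toFun := fun a => a ⊗ₖ (1 : Matrix κ κ ℝ)
      map_add' := fun a b => Matrix.add_kronecker a b _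
      map_smul' := fun c a => Matrix.smul_kronecker c a _ }
    Matrix.one_kronecker_one fun a b => by
      change (a * b) ⊗ₖ (1 : Matrix κ κ ℝ) = a ⊗ₖ (1 : Matrix κ κ ℝ) * b ⊗ₖ (1 : Matrix κ κ ℝ)
      rw [← Matrix.mul_kronecker_mul, one_mul]

open scoped Kronecker in
/-- The algebra homomorphism `b ↦ 1 ⊗ b` on matrices. -/
def kroneckerRight (ι κ : Type) [Fintype ι] [DecidableEq ι] [Fintype κ] [DecidableEq κ] :
    Matrix κ κ ℝ →ₐ[ℝ] Matrix (ι × κ) (ι × κ) ℝ :=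
  AlgHom.ofLinearMap
    { toFun := fun b => (1 : Matrix ι ι ℝ) ⊗ₖ b
      map_add' := fun a b => Matrix.kronecker_add _ a b
      map_smul' := fun c a => Matrix.kronecker_smul c _ a }
    Matrix.one_kronecker_one fun a b => by
      change (1 : Matrix ι ι ℝ) ⊗ₖ (a * b) = (1 : Matrix ι ι ℝ) ⊗ₖ a * (1 : Matrix ι ι ℝ) ⊗ₖ b
      rw [← Matrix.mul_kronecker_mul, one_mul]

open scoped Kronecker in
theorem kroneckerLeft_mul_kroneckerRight (a : Matrix ι ι ℝ) (b : Matrix κ κ ℝ) :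
    kroneckerLeft ι κ a * kroneckerRight ι κ b = a ⊗ₖ b := by
  change a ⊗ₖ (1 : Matrix κ κ ℝ) * (1 : Matrix ι ι ℝ) ⊗ₖ b = _
  rw [← Matrix.mul_kronecker_mul, one_mul, mul_one]

open scoped Kronecker in
theorem commute_kroneckerLeft_kroneckerRight (a : Matrix ι ι ℝ) (b : Matrix κ κ ℝ) :
    Commute (kroneckerLeft ι κ a) (kroneckerRight ι κ b) := by
  rw [Commute, SemiconjBy, kroneckerLeft_mul_kroneckerRight]
  change _ = (1 : Matrix ι ι ℝ) ⊗ₖ b * a ⊗ₖ (1 : Matrix κ κ ℝ)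
  rw [← Matrix.mul_kronecker_mul, one_mul, mul_one]

/-- The Kronecker sum of two matrices of functionals. -/
def kroneckerSum (M : ι → ι → StrongDual ℝ F) (M' : κ → κ → StrongDual ℝ F) :
    ι × κ → ι × κ → StrongDual ℝ F :=
  fun p q => (1 : Matrix κ κ ℝ) p.2 q.2 • M p.1 q.1 + (1 : Matrix ι ι ℝ) p.1 q.1 • M' p.2 q.2

theorem matrixRep_kroneckerSum (M : ι → ι → StrongDual ℝ F) (M' : κ → κ → StrongDual ℝ F) :
    matrixRep (kroneckerSum M M') = (kroneckerLeft ι κ).toLinearMap ∘ₗ matrixRep M +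
      (kroneckerRight ι κ).toLinearMap ∘ₗ matrixRep M' := by
  ext v p q
  change (1 : Matrix κ κ ℝ) p.2 q.2 * M p.1 q.1 v + (1 : Matrix ι ι ℝ) p.1 q.1 * M' p.2 q.2 v =
    M p.1 q.1 v * (1 : Matrix κ κ ℝ) p.2 q.2 + (1 : Matrix ι ι ℝ) p.1 q.1 * M' p.2 q.2 v
  rw [mul_comm]

/-- The two summands `a ⊗ 1` and `1 ⊗ b` commute, so the development along the sum is the product of
the two developments; entries of a Kronecker product are products of entries. -/
theorem tensorDev_kroneckerSum (M : ι → ι → StrongDual ℝ F) (M' : κ → κ → StrongDual ℝ F)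
    (l : List F) (m : ℕ) (p q : ι × κ) :
    tensorDev (matrixRep (kroneckerSum M M')) m
        (TensorSeries.listProd (l.map TensorSeries.exp) m) p q =
      ∑ k ∈ Finset.HasAntidiagonal.antidiagonal m,
        tensorDev (matrixRep M) k.1 (TensorSeries.listProd (l.map TensorSeries.exp) k.1) p.1 q.1 *
        tensorDev (matrixRep M') k.2 (TensorSeries.listProd (l.map TensorSeries.exp) k.2)
          p.2 q.2 := by
  have h := congrArg (PowerSeries.coeff m) (devSeries_add
    (L := (kroneckerLeft ι κ).toLinearMap ∘ₗ matrixRep M)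
    (L' := (kroneckerRight ι κ).toLinearMap ∘ₗ matrixRep M')
    (fun v w => commute_kroneckerLeft_kroneckerRight _ _) l)
  rw [PowerSeries.coeff_mul, ← matrixRep_kroneckerSum] at h
  simp only [devSeries, PowerSeries.coeff_mk, tensorDev_comp,
    kroneckerLeft_mul_kroneckerRight] at h
  rw [h, Matrix.sum_apply]
  rfl

variable (F) in
/-- A coordinate of the tensor algebra, given as an entry of the development along a matrix of
functionals, at a certain level. -/
structure Coordinate where
  /-- index set of the matrix -/
  ι : Type
  [fintype : Fintype ι]
  [decEq : DecidableEq ι]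
  /-- matrix of functionals -/
  M : ι → ι → StrongDual ℝ F
  /-- row -/
  i : ι
  /-- column -/
  j : ι
  /-- tensor level -/
  level : ℕ

attribute [instance] Coordinate.fintype Coordinate.decEq

namespace Coordinate

/-- The value of a coordinate on a tensor. -/
def val (q : Coordinate F) : (⨂[ℝ]^q.level F) →ₗ[ℝ] ℝ :=
  LinearMap.proj q.j ∘ₗ LinearMap.proj q.i ∘ₗ tensorDev (matrixRep q.M) q.level

/-- The value of a coordinate on a tensor series. -/
def eval (q : Coordinate F) (s : TensorSeries F) : ℝ := q.val (s q.level)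

theorem eval_eq (q : Coordinate F) (s : TensorSeries F) :
    q.eval s = tensorDev (matrixRep q.M) q.level (s q.level) q.i q.j := rfl

/-- The coordinate that is constant on group-like tensors. -/
def unit : Coordinate F where
  ι := Unit
  M := 0
  i := ()
  j := ()
  level := 0

theorem unit_eval (l : List F) :
    (unit : Coordinate F).eval (TensorSeries.listProd (l.map TensorSeries.exp)) = 1 := by
  change tensorDev (matrixRep (0 : Unit → Unit → StrongDual ℝ F)) 0
    (TensorSeries.listProd (l.map TensorSeries.exp) 0) () () = 1
  rw [TensorSeries.listProd_exp_zero, tensorDev_tprod, List.ofFn_zero, List.prod_nil,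
    Matrix.one_apply_eq]

/-- The product of two coordinates, as functions of group-like tensors. -/
def mul (q q' : Coordinate F) : Coordinate F where
  ι := (q.ι × Fin (q.level + 1)) × (q'.ι × Fin (q'.level + 1))
  M := kroneckerSum (unroll q.M q.level) (unroll q'.M q'.level)
  i := ((q.i, 0), (q'.i, 0))
  j := ((q.j, Fin.last _), (q'.j, Fin.last _))
  level := q.level + q'.level

/-- The Kronecker sum alone would give a sum over all ways to split the total degree. Unrolling both
matrices and going from the first level to the last leaves only the split `(q.level, q'.level)`. -/
theorem mul_eval (q q' : Coordinate F) (l : List F) :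
    (q.mul q').eval (TensorSeries.listProd (l.map TensorSeries.exp)) =
      q.eval (TensorSeries.listProd (l.map TensorSeries.exp)) *
        q'.eval (TensorSeries.listProd (l.map TensorSeries.exp)) := by
  refine (tensorDev_kroneckerSum (unroll q.M q.level) (unroll q'.M q'.level) l
    (q.level + q'.level) _ _).trans ?_
  simp only [tensorDev_unroll]
  rw [Finset.sum_eq_single (q.level, q'.level)]
  · simp [mul, eval_eq]
  · rintro ⟨a, b⟩ hab hne
    have hab' := Finset.HasAntidiagonal.mem_antidiagonal.1 hab
    by_cases ha : q.level = a
    · exact absurd (Prod.ext ha.symm (by simp only at hab' ⊢; omega)) hne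
    · simp [mul, ha]
  · simp

/-- Coordinates extend to continuous functionals on the tensor algebra. -/
theorem exists_functional (q : Coordinate F) (N : AdmissibleNorm F) :
    ∃ Ψ : TensorAlg N →L[ℝ] ℝ, ∀ (t : TensorAlg N) (u : ⨂[ℝ]^q.level F),
      t q.level = toCompletion N u → Ψ t = q.val u := by
  obtain ⟨C, hC⟩ := exists_bound_entry N q.M q.level q.i q.j
  -- The coordinate is bounded on the algebraic tensor power, hence extends to the completion;
  -- projection onto the level then gives a functional on the whole algebra.
  let f : NormedPower N q.level →L[ℝ] ℝ :=
    LinearMap.mkContinuous (E := NormedPower N q.level) q.val C hC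
  let e : NormedPower N q.level →L[ℝ] UniformSpace.Completion (NormedPower N q.level) :=
    UniformSpace.Completion.toComplL
  refine ⟨(f.extend e).comp (lp.evalCLM ℝ _ 1 q.level), fun t u h => ?_⟩
  change f.extend e (t q.level) = _
  rw [h]
  exact f.extend_eq (UniformSpace.Completion.denseRange_coe)
    (UniformSpace.Completion.isUniformInducing_coe _) u

end Coordinate

end Coordinates

/-! ### Recovering a path from the coordinates of its signature. -/

section Separation

variable {F : Type u} [NormedAddCommGroup F] [NormedSpace ℝ F]

/-- The power series of the `(i, j)` entries. -/
def entrySeries {ι : Type} [Fintype ι] [DecidableEq ι] (f : PowerSeries (Matrix ι ι ℝ)) (i j : ι) :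
    PowerSeries ℝ :=
  PowerSeries.mk fun m => PowerSeries.coeff m f i j

theorem entrySeries_mul {ι : Type} [Fintype ι] [DecidableEq ι] (f g : PowerSeries (Matrix ι ι ℝ))
    (i j : ι) : entrySeries (f * g) i j = ∑ k, entrySeries f i k * entrySeries g k j := by
  ext m
  simp only [entrySeries, PowerSeries.coeff_mk, map_sum, PowerSeries.coeff_mul, Matrix.sum_apply,
    Matrix.mul_apply]
  exact Finset.sum_comm

/-- The matrix of functionals with developments given by the words `τ ⋯ τ ℓ`. -/
def wordMatrix (τ ℓ : StrongDual ℝ F) : Fin 2 → Fin 2 → StrongDual ℝ F :=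
  ![![τ, ℓ], ![0, 0]]

/-- With unit time increment the matrix is idempotent, so its exponential is `1 + (exp z - 1)` times
the matrix. -/
theorem matrixRep_wordMatrix_pow (τ ℓ : StrongDual ℝ F) {v : F} (hv : τ v = 1) (m : ℕ) :
    matrixRep (wordMatrix τ ℓ) v ^ (m + 1) = !![1, ℓ v; 0, 0] := by
  have h : matrixRep (wordMatrix τ ℓ) v = !![1, ℓ v; 0, 0] := by
    ext i j
    fin_cases i <;> fin_cases j <;> simp [matrixRep_apply, wordMatrix, hv]
  rw [h]
  refine IsIdempotentElem.pow_succ_eq m ?_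
  ext i j
  fin_cases i <;> fin_cases j <;> simp [Matrix.mul_apply]

theorem entrySeries_expSeries_wordMatrix (τ ℓ : StrongDual ℝ F) {v : F} (hv : τ v = 1) :
    entrySeries (expSeries (matrixRep (wordMatrix τ ℓ) v)) 0 0 = PowerSeries.exp ℝ ∧
    entrySeries (expSeries (matrixRep (wordMatrix τ ℓ) v)) 0 1 =
      (PowerSeries.exp ℝ - 1) * PowerSeries.C (ℓ v) ∧
    entrySeries (expSeries (matrixRep (wordMatrix τ ℓ) v)) 1 0 = 0 ∧
    entrySeries (expSeries (matrixRep (wordMatrix τ ℓ) v)) 1 1 = 1 := by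
  refine ⟨?_, ?_, ?_, ?_⟩ <;> ext m <;> cases m <;>
    simp [entrySeries, expSeries, matrixRep_wordMatrix_pow τ ℓ hv, PowerSeries.coeff_exp,
      PowerSeries.coeff_one]

/-- In a product of upper triangular matrices with diagonal `(exp z, 1)`, the off-diagonal entry of
factor `t` is multiplied by the `t` diagonal entries `exp z` before it. -/
theorem entrySeries_devSeries_wordMatrix (τ ℓ : StrongDual ℝ F) {n : ℕ} (v : Fin n → F)
    (hv : ∀ t, τ (v t) = 1) :
    entrySeries (devSeries (matrixRep (wordMatrix τ ℓ))
      (TensorSeries.listProd ((List.ofFn v).map TensorSeries.exp))) 0 1 =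
      (PowerSeries.exp ℝ - 1) * ∑ t, PowerSeries.C (ℓ (v t)) * PowerSeries.exp ℝ ^ (t : ℕ) := by
  rw [devSeries_listProd, List.map_ofFn]
  -- The induction also needs the lower diagonal entry of the product.
  refine (And.left (b := entrySeries (List.ofFn ((fun v => expSeries
    (matrixRep (wordMatrix τ ℓ) v)) ∘ v)).prod 1 1 = 1) ?_)
  induction n with
  | zero => constructor <;> ext m <;> simp [entrySeries, PowerSeries.coeff_one] <;>
      split_ifs <;> simp
  | succ n ih =>
    obtain ⟨h1, h2⟩ := ih (fun t => v t.succ) fun t => hv t.succ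
    obtain ⟨e1, e2, e3, e4⟩ := entrySeries_expSeries_wordMatrix τ ℓ (hv 0)
    simp only [Function.comp_def] at h1 h2 ⊢
    rw [List.ofFn_succ, List.prod_cons, entrySeries_mul, entrySeries_mul, Fin.sum_univ_two,
      Fin.sum_univ_two, e1, e2, e3, e4, h1, h2, Fin.sum_univ_succ]
    refine ⟨?_, by ring⟩
    simp only [Fin.val_zero, pow_zero, mul_one, Fin.val_succ, pow_succ, mul_add, Finset.mul_sum]
    rw [add_comm]
    congr 1
    exact Finset.sum_congr rfl fun t _ => by ring

/-- The coefficients of `exp (t z)` are `t ^ m / m !`, so the first `n` of them form a Vandermonde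
system with distinct nodes. -/
theorem eq_zero_of_sum_exp_pow_eq_zero {n : ℕ} {d : Fin n → ℝ}
    (h : ∑ t, PowerSeries.C (d t) * PowerSeries.exp ℝ ^ (t : ℕ) = 0) : d = 0 := by
  refine Matrix.eq_zero_of_forall_pow_sum_mul_pow_eq_zero (f := fun t : Fin n => ((t : ℕ) : ℝ))
    (fun a b hab => Fin.ext (Nat.cast_injective hab)) fun m => ?_
  have hm := congrArg (PowerSeries.coeff (m : ℕ)) h
  simp only [map_sum, PowerSeries.coeff_C_mul, PowerSeries.exp_pow_eq_rescale_exp,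
    PowerSeries.coeff_rescale, PowerSeries.coeff_exp, map_zero] at hm
  have hf : ((m : ℕ)! : ℝ) ≠ 0 := by positivity
  have e : ∑ t : Fin n, d t * ((t : ℕ) : ℝ) ^ (m : ℕ) = ((m : ℕ)! : ℝ) *
      ∑ t : Fin n, d t * (((t : ℕ) : ℝ) ^ (m : ℕ) * algebraMap ℚ ℝ (1 / (m : ℕ)!)) := by
    rw [Finset.mul_sum]
    refine Finset.sum_congr rfl fun t _ => ?_
    simp only [one_div, map_inv₀, map_natCast]
    field_simp
  rw [e, hm, mul_zero]

/-- The coordinate given by the word `τ ⋯ τ ℓ`. -/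
def Coordinate.word (τ ℓ : StrongDual ℝ F) (m : ℕ) : Coordinate F where
  ι := Fin 2
  M := wordMatrix τ ℓ
  i := 0
  j := 1
  level := m

theorem Coordinate.word_eval (τ ℓ : StrongDual ℝ F) (m : ℕ) (s : TensorSeries F) :
    (Coordinate.word τ ℓ m).eval s =
      PowerSeries.coeff m (entrySeries (devSeries (matrixRep (wordMatrix τ ℓ)) s) 0 1) := by
  rw [entrySeries, PowerSeries.coeff_mk, devSeries, PowerSeries.coeff_mk]
  rfl

/-- Paths with unit time increments are determined by the coordinates of a dilation of their
signature. -/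
theorem eq_of_coordinates_eq {n : ℕ} (hn : n ≠ 0) (τ : StrongDual ℝ F) {v w : Fin n → F}
    (hv : ∀ t, τ (v t) = 1) (hw : ∀ t, τ (w t) = 1) {c c' : ℝ}
    (hc : 0 < c)
    (h : ∀ q : Coordinate F,
      c ^ q.level * q.eval (TensorSeries.listProd ((List.ofFn v).map TensorSeries.exp)) =
      c' ^ q.level * q.eval (TensorSeries.listProd ((List.ofFn w).map TensorSeries.exp))) :
    v = w := by
  have hlevel : ∀ u : Fin n → F, (∀ t, τ (u t) = 1) → (Coordinate.word τ τ 1).eval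
      (TensorSeries.listProd ((List.ofFn u).map TensorSeries.exp)) = n := by
    intro u hu
    rw [Coordinate.word_eval, entrySeries_devSeries_wordMatrix τ τ u hu, PowerSeries.coeff_mul,
      Finset.Nat.sum_antidiagonal_eq_sum_range_succ_mk]
    simp [Finset.sum_range_succ, PowerSeries.coeff_exp, hu, PowerSeries.coeff_one]
  -- The total elapsed time is the same nonzero number `n` for both paths, so the level one time
  -- coordinate reveals the dilation factor.
  have hcc : c = c' := by
    have h1 := h (Coordinate.word τ τ 1)
    rw [hlevel v hv, hlevel w hw] at h1
    have h2 : (n : ℝ) ≠ 0 := Nat.cast_ne_zero.2 hn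
    simpa [Coordinate.word, h2] using h1
  subst hcc
  funext t
  refine (SeparatingDual.eq_iff_forall_dual_eq (R := ℝ)).2 fun ℓ => ?_
  have hs : entrySeries (devSeries (matrixRep (wordMatrix τ ℓ))
      (TensorSeries.listProd ((List.ofFn v).map TensorSeries.exp))) 0 1 =
      entrySeries (devSeries (matrixRep (wordMatrix τ ℓ))
      (TensorSeries.listProd ((List.ofFn w).map TensorSeries.exp))) 0 1 := by
    ext m
    rw [← Coordinate.word_eval, ← Coordinate.word_eval]
    exact mul_left_cancel₀ (pow_pos hc _).ne' (h (Coordinate.word τ ℓ m))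
  rw [entrySeries_devSeries_wordMatrix τ ℓ v hv, entrySeries_devSeries_wordMatrix τ ℓ w hw] at hs
  -- Real power series have no zero divisors, so this common factor cancels and leaves a combination
  -- of the powers of `exp z`.
  have hne : PowerSeries.exp ℝ - 1 ≠ 0 := by
    intro h0
    have := congrArg (PowerSeries.coeff 1) h0
    simp [PowerSeries.coeff_exp, PowerSeries.coeff_one] at this
  have hs' := mul_left_cancel₀ hne hs
  have hz := eq_zero_of_sum_exp_pow_eq_zero (d := fun t => ℓ (v t) - ℓ (w t)) (by
    simp only [map_sub, sub_mul, Finset.sum_sub_distrib, hs', sub_self])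
  exact sub_eq_zero.1 (congrFun hz t)

variable {E : Type u} [NormedAddCommGroup E] [NormedSpace ℝ E] {T : ℕ}

theorem increment_injective {x y : Fin (T + 1) → E} (h : increment x = increment y) : x = y := by
  have hsnd : ∀ t, (increment x t).snd = (increment y t).snd := fun t => by rw [h]
  funext t
  induction t using Fin.induction with
  | zero => exact hsnd 0
  | succ s ih =>
    have h1 : x s.succ - x s.castSucc = y s.succ - y s.castSucc := hsnd s.succ
    rw [ih] at h1
    exact sub_left_injective h1

variable (E) in
/-- The time coordinate on `ℝ ⊕ E`. -/
def timeDual : StrongDual ℝ (Aug E) :=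
  (ContinuousLinearMap.fst ℝ ℝ E).comp (WithLp.prodContinuousLinearEquiv 1 ℝ ℝ E).toContinuousLinearMap

theorem timeDual_increment (x : Fin (T + 1) → E) (t : Fin (T + 1)) :
    timeDual E (increment x t) = 1 := rfl

theorem eq_of_signature_coordinates_eq {x y : Fin (T + 1) → E} {c c' : ℝ} (hc : 0 < c)
    (h : ∀ q : Coordinate (Aug E), c ^ q.level * q.eval (signatureSeries x) =
      c' ^ q.level * q.eval (signatureSeries y)) : x = y := by
  simp only [signatureSeries_eq] at h
  exact increment_injective (eq_of_coordinates_eq (Nat.succ_ne_zero T) (timeDual E)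
    (timeDual_increment x) (timeDual_increment y) hc h)

end Separation

/-! ### Expected normalized signatures as maps on probability measures. -/

section ExpectedSignature

variable {G : Type u} [NormedAddCommGroup G] [NormedSpace ℝ G] {N : AdmissibleNorm (Aug G)}
  {T : ℕ}

/-- A continuous map on the tensors with `t_0 = 1` of the form `t ↦ δ_{λ(t)} t`. -/
structure IsDilation (N : AdmissibleNorm (Aug G)) (Λ : TensorAlg N → TensorAlg N) : Prop where
  dilation : ∀ t ∈ unitTensors N, ∃ c : ℝ, 0 < c ∧ ∀ m, Λ t m = c ^ m • t m
  continuousOn : ContinuousOn Λ (unitTensors N)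

theorem IsTensorNormalization.isDilation {Λ : TensorAlg N → TensorAlg N}
    (h : IsTensorNormalization N Λ) : IsDilation N Λ :=
  ⟨h.dilation, h.continuousOn⟩

theorem isDilation_id : IsDilation N fun t => t :=
  ⟨fun _ _ => ⟨1, one_pos, fun m => by simp⟩, continuousOn_id⟩

variable {Λ : TensorAlg N → TensorAlg N} {E : Type u} [TopologicalSpace E]

theorem IsDilation.continuous_signature (hΛ : IsDilation N Λ) {e : E → G} (he : Continuous e) :
    Continuous fun x : Fin (T + 1) → E => Λ (signature N fun t => e (x t)) :=
  hΛ.continuousOn.comp_continuous ((AdaptedTop.continuous_signature N).comp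
    (continuous_pi fun t => he.comp (continuous_apply t))) fun _ => signature_mem_unitTensors N _

variable [SecondCountableTopology E] [MeasurableSpace E] [BorelSpace E]

theorem continuous_integral_signature (hΛ : IsDilation N Λ) {e : E → G} (he : Continuous e) {K : ℝ}
    (hK : ∀ x : Fin (T + 1) → E, ‖Λ (signature N fun t => e (x t))‖ ≤ K) :
    Continuous fun μ : ProbabilityMeasure (Fin (T + 1) → E) =>
      ∫ x, Λ (signature N fun t => e (x t)) ∂(μ : Measure (Fin (T + 1) → E)) :=
  continuous_integral_of_bounded (hΛ.continuous_signature he) hK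

variable [StandardBorelSpace E]

/-- A dilation by `c` multiplies a coordinate of level `n` by `c ^ n`, so products of coordinates of
the normalized signature are again such coordinates. They separate paths, and their integrals are
functionals of the expected signature. -/
theorem injective_integral_signature (hΛ : IsDilation N Λ) {e : E → G} (he : Continuous e)
    (hei : Function.Injective e) {K : ℝ}
    (hK : ∀ x : Fin (T + 1) → E, ‖Λ (signature N fun t => e (x t))‖ ≤ K) :
    Function.Injective fun μ : ProbabilityMeasure (Fin (T + 1) → E) =>
      ∫ x, Λ (signature N fun t => e (x t)) ∂(μ : Measure (Fin (T + 1) → E)) := by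
  intro μ ν hμν
  have hcont := hΛ.continuous_signature (T := T) he
  have hint : ∀ ρ : ProbabilityMeasure (Fin (T + 1) → E),
      Integrable (fun x => Λ (signature N fun t => e (x t))) (ρ : Measure (Fin (T + 1) → E)) :=
    fun ρ => Integrable.of_bound hcont.aestronglyMeasurable K (ae_of_all _ hK)
  choose c hc hcΛ using fun x : Fin (T + 1) → E =>
    hΛ.dilation _ (signature_mem_unitTensors N fun t => e (x t))
  have hfun : ∀ q : Coordinate (Aug G), ∃ Ψ : TensorAlg N →L[ℝ] ℝ, ∀ x : Fin (T + 1) → E,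
      Ψ (Λ (signature N fun t => e (x t))) =
        c x ^ q.level * q.eval (signatureSeries fun t => e (x t)) := by
    intro q
    obtain ⟨Ψ, hΨ⟩ := q.exists_functional N
    refine ⟨Ψ, fun x => ?_⟩
    rw [hΨ _ (c x ^ q.level • signatureSeries (fun t => e (x t)) q.level), map_smul]
    · rfl
    · rw [hcΛ]
      exact (UniformSpace.Completion.coe_smul (X := NormedPower N q.level) (c x ^ q.level)
        (signatureSeries (fun t => e (x t)) q.level)).symm
  -- The factor `c x` depends on the path; closure under products works since levels add under
  -- `Coordinate.mul`.
  let 𝒢 : Submonoid ((Fin (T + 1) → E) →ᵇ ℝ) :=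
    { carrier := {f | ∃ q : Coordinate (Aug G), ∀ x,
        f x = c x ^ q.level * q.eval (signatureSeries fun t => e (x t))}
      one_mem' := ⟨Coordinate.unit, fun x => by
        rw [signatureSeries_eq, Coordinate.unit_eval]
        simp [Coordinate.unit]⟩
      mul_mem' := by
        rintro f g ⟨q, hq⟩ ⟨q', hq'⟩
        refine ⟨q.mul q', fun x => ?_⟩
        rw [BoundedContinuousFunction.mul_apply, hq, hq', signatureSeries_eq, Coordinate.mul_eval]
        simp only [Coordinate.mul, pow_add]
        ring }
  refine probabilityMeasure_ext_of_subalgebra (Algebra.adjoin ℝ (𝒢 : Set _)) ?_ ?_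
  · intro x y hxy
    by_contra! hcon
    refine hxy (funext fun t => hei (congrFun (eq_of_signature_coordinates_eq
      (x := fun t => e (x t)) (y := fun t => e (y t)) (hc x) (c' := c y) fun q => ?_) t))
    obtain ⟨Ψ, hΨ⟩ := hfun q
    rw [← hΨ, ← hΨ]
    exact hcon (BoundedContinuousFunction.ofNormedAddCommGroup
      (fun x => Ψ (Λ (signature N fun t => e (x t)))) (Ψ.continuous.comp hcont) (‖Ψ‖ * K)
      fun x => (Ψ.le_opNorm _).trans (by gcongr; exact hK x))
      (Algebra.subset_adjoin ⟨q, hΨ⟩)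
  · intro f hf
    -- The algebra generated by a monoid is its linear span, so linearity of the integral reduces
    -- the claim to single coordinates.
    rw [← Subalgebra.mem_toSubmodule, Algebra.adjoin_eq_span, Submonoid.closure_eq] at hf
    induction hf using Submodule.span_induction with
    | mem f hf =>
      obtain ⟨q, hq⟩ := hf
      obtain ⟨Ψ, hΨ⟩ := hfun q
      simp only [hq, ← hΨ]
      rw [Ψ.integral_comp_comm (hint μ), Ψ.integral_comp_comm (hint ν)]
      exact congrArg Ψ hμν
    | zero => simp
    | add f g _ _ hf hg =>
      simp only [BoundedContinuousFunction.add_apply]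
      rw [integral_add (f.integrable _) (g.integrable _),
        integral_add (f.integrable _) (g.integrable _), hf, hg]
    | smul a f _ hf =>
      simp only [BoundedContinuousFunction.smul_apply]
      rw [integral_smul, integral_smul, hf]

end ExpectedSignature

/-! ### Comparison of a compact topology with a coarser Hausdorff one. -/

section CompactTopologies

theorem eq_of_le_of_compact_of_t2 {X : Type*} {s t : TopologicalSpace X} (h : s ≤ t)
    (hs : @CompactSpace X s) (ht : @T2Space X t) : s = t :=
  le_antisymm h (continuous_id_iff_le.1
    (@Continuous.continuous_symm_of_equiv_compact_to_t2 X X s t hs ht (Equiv.refl X)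
      (continuous_id_iff_le.2 h)))

/-- Two topologies of which the coarser one is Hausdorff agree on the preimage of a set that is
compact for the finer one. -/
theorem induced_val_eq_of_isCompact {S P : Type*} (L : S → P) {t t' : TopologicalSpace P}
    (h : t ≤ t') (ht' : @T2Space P t') {K : Set S} (hK : @IsCompact S (induced L t) K) :
    induced (Subtype.val : K → S) (induced L t) = induced (Subtype.val : K → S) (induced L t') := by
  have hK' : @IsCompact P t (L '' K) := @IsCompact.image S P (induced L t) t K L hK
    continuous_induced_dom
  have hc : @CompactSpace (L '' K) (induced Subtype.val t) :=
    (@isCompact_iff_compactSpace P t (L '' K)).1 hK'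
  have h2 : @T2Space (L '' K) (induced Subtype.val t') :=
    @T2Space.of_injective_continuous _ _ (induced Subtype.val t') t' ht' Subtype.val
      Subtype.val_injective continuous_induced_dom
  have e := eq_of_le_of_compact_of_t2 (induced_mono h) hc h2
  -- The comparison takes place on the image `L '' K`, since topologies induced by `L` on `K` itself
  -- need not be Hausdorff.
  have hfac : L ∘ (Subtype.val : K → S) =
      (Subtype.val : L '' K → P) ∘ fun x : K => ⟨L x, x, x.2, rfl⟩ := rfl
  rw [induced_compose, induced_compose, hfac, ← induced_compose, ← induced_compose, e]

end CompactTopologies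

/-! ### Higher rank expected signatures and equality of the topologies. -/

section Main

variable {N : AdmissibleNormSystem.{u}} {V : Type u} [NormedAddCommGroup V] [NormedSpace ℝ V]
  [CompleteSpace V] {T : ℕ} {E : State.{u}}

/-- The normalized signatures of continuous images of rank `k` paths are bounded, for all `k`. -/
def Lift.IsBounded (T : ℕ) (E : State.{u}) (Λ : Lift N V) : Prop :=
  ∀ (k : ℕ) (e : rankProb T E k → tensorSpace N V k), Continuous e →
    ∃ K : ℝ, ∀ x : Fin (T + 1) → rankProb T E k,
      ‖Λ k (signature (N k (Aug (tensorSpace N V k))) fun t => e (x t))‖ ≤ K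

theorem Lift.IsNormalization.isBounded {Λ : Lift N V} (hΛ : Λ.IsNormalization) :
    Λ.IsBounded T E := fun k _ _ =>
  (hΛ k).bounded.imp fun _ hK _ => hK _ (signature_mem_unitTensors _ _)

theorem compactSpace_rankProb [CompactSpace E] (k : ℕ) : CompactSpace (rankProb T E k) := by
  induction k with
  | zero => assumption
  | succ k ih =>
    exact inferInstanceAs (CompactSpace (ProbabilityMeasure (Fin (T + 1) → rankProb T E k)))

theorem Lift.isBounded_classical [CompactSpace E] : (Lift.classical N V).IsBounded T E := by
  intro k e he
  have := compactSpace_rankProb (T := T) (E := E) k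
  obtain ⟨K, hK⟩ := isCompact_univ.exists_bound_of_continuousOn
    ((isDilation_id (N := N k (Aug (tensorSpace N V k)))).continuous_signature (T := T)
      he).continuousOn
  exact ⟨K, fun x => hK x trivial⟩

/-- Induction on the rank. Boundedness is assumed for all continuous embeddings of the state space,
not for `ESig^k` directly, so that it becomes available once continuity at rank `k` is known. -/
theorem continuous_injective_expectedSignature {Λ : Lift N V}
    (hΛ : ∀ k, IsDilation (N k (Aug (tensorSpace N V k))) (Λ k)) (hb : Λ.IsBounded T E)
    {ι : E → V} (hι : Continuous ι) (hi : Function.Injective ι) (k : ℕ) :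
    Continuous (expectedSignature (T := T) Λ ι k) ∧
      Function.Injective (expectedSignature (T := T) Λ ι k) := by
  induction k with
  | zero => exact ⟨hι, hi⟩
  | succ k ih =>
    obtain ⟨K, hK⟩ := hb k _ ih.1
    exact ⟨continuous_integral_signature (hΛ k) ih.1 hK,
      injective_integral_signature (hΛ k) ih.1 ih.2 hK⟩

theorem sigTopology_eq_sigDistTopology (Λ : Lift N V) (ι : E → V) (r : ℕ) :
    sigTopology.{u, w} (T := T) Λ ι r = sigDistTopology.{u, w} (T := T) Λ ι r := by
  let := sigPseudoMetric.{u, w} (T := T) Λ ι r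
  have h : Isometry (Phi.{u, w} (T := T) Λ ι r) :=
    Isometry.of_dist_eq fun X Y => dist_eq_norm _ _
  exact h.isUniformInducing.isInducing.eq_induced.symm

theorem sigTopology_eq_induced (Λ : Lift N V) (ι : E → V) (r : ℕ) :
    sigTopology.{u, w} (T := T) Λ ι r = induced (AdaptedProcess.predictionLaw.{u, w} r)
      (induced (expectedSignature (T := T) Λ ι (r + 1)) inferInstance) :=
  (induced_compose (g := expectedSignature (T := T) Λ ι (r + 1))).symm

variable {Λ : Lift N V} {ι : E → V}

theorem t2Space_induced_expectedSignature
    (hΛ : ∀ k, IsDilation (N k (Aug (tensorSpace N V k))) (Λ k)) (hb : Λ.IsBounded T E)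
    (hι : Continuous ι) (hi : Function.Injective ι) (k : ℕ) :
    @T2Space _ (induced (expectedSignature (T := T) Λ ι k) inferInstance) :=
  @T2Space.of_injective_continuous _ _ (induced (expectedSignature (T := T) Λ ι k) inferInstance) _
    _ _ (continuous_injective_expectedSignature hΛ hb hι hi k).2 continuous_induced_dom

/-- The equalities hold already on the compact space of laws of rank `r` paths and are then pulled
back; the class of processes itself need not be Hausdorff. -/
theorem topologies_eq_of_compactSpace [CompactSpace E]
    (hΛ : ∀ k, IsDilation (N k (Aug (tensorSpace N V k))) (Λ k)) (hb : Λ.IsBounded T E)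
    (hι : Continuous ι) (hi : Function.Injective ι) (r : ℕ) :
    adaptedTopology.{u, w} T E r = extendedWeakTopology.{u, w} T E r ∧
      extendedWeakTopology.{u, w} T E r = sigTopology.{u, w} (T := T) Λ ι r := by
  have := compactSpace_rankProb (T := T) (E := E) r
  rw [adaptedTopology_eq_induced, extendedWeakTopology_eq_induced, sigTopology_eq_induced]
  constructor
  · rw [← eq_of_le_of_compact_of_t2 (le_functionalTopology.{u, w} (T := T) (E := E) r)
      inferInstance (t2Space_functionalTopology r)]
  · congr 1
    exact eq_of_le_of_compact_of_t2 (continuous_iff_le_induced.1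
      (continuous_injective_expectedSignature hΛ hb hι hi (r + 1)).1) inferInstance
      (t2Space_induced_expectedSignature hΛ hb hι hi (r + 1))

theorem topologies_eq_on_isCompact
    (hΛ : ∀ k, IsDilation (N k (Aug (tensorSpace N V k))) (Λ k)) (hb : Λ.IsBounded T E)
    (hι : Continuous ι) (hi : Function.Injective ι) (r : ℕ) {K : Set (AdaptedProcess.{u, w} T E)}
    (hK : @IsCompact _ (extendedWeakTopology.{u, w} T E r) K) :
    induced (Subtype.val : K → _) (adaptedTopology.{u, w} T E r) =
        induced (Subtype.val : K → _) (extendedWeakTopology.{u, w} T E r) ∧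
      induced (Subtype.val : K → _) (extendedWeakTopology.{u, w} T E r) =
        induced (Subtype.val : K → _) (sigTopology.{u, w} (T := T) Λ ι r) := by
  rw [extendedWeakTopology_eq_induced] at hK
  rw [adaptedTopology_eq_induced, extendedWeakTopology_eq_induced, sigTopology_eq_induced]
  exact ⟨(induced_val_eq_of_isCompact _ (le_functionalTopology r)
    (t2Space_functionalTopology r) hK).symm,
    induced_val_eq_of_isCompact _ (continuous_iff_le_induced.1
      (continuous_injective_expectedSignature hΛ hb hι hi (r + 1)).1)
      (t2Space_induced_expectedSignature hΛ hb hι hi (r + 1)) hK⟩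

end Main

end AdaptedTop

end

theorem theorem4p1 {V : Type u} [NormedAddCommGroup V] [NormedSpace ℝ V] [CompleteSpace V]
    [SeparableSpace V] [MeasurableSpace V] [BorelSpace V]
    (N : AdaptedTop.AdmissibleNormSystem.{u}) (T r : ℕ) (U : Set V) (hU : MeasurableSet U) :
    -- compact state space, classical or robust signatures
    (IsCompact U →
      ∀ Λ : AdaptedTop.Lift N V, Λ = AdaptedTop.Lift.classical N V ∨ Λ.IsNormalization →
        AdaptedTop.adaptedTopology.{u, w} T (AdaptedTop.State.ofSet U hU) r =
            AdaptedTop.extendedWeakTopology.{u, w} T (AdaptedTop.State.ofSet U hU) r ∧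
          AdaptedTop.extendedWeakTopology.{u, w} T (AdaptedTop.State.ofSet U hU) r =
            AdaptedTop.sigTopology.{u, w} (T := T) Λ (AdaptedTop.State.incl U hU) r ∧
          AdaptedTop.sigTopology.{u, w} (T := T) Λ (AdaptedTop.State.incl U hU) r =
            AdaptedTop.sigDistTopology.{u, w} (T := T) Λ (AdaptedTop.State.incl U hU) r) ∧
    -- general state space, robust signatures: the topologies agree on compact sets of processes
    (∀ Λ : AdaptedTop.Lift N V, Λ.IsNormalization →
      ∀ K : Set (AdaptedTop.AdaptedProcess.{u, w} T (AdaptedTop.State.ofSet U hU)),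
        @IsCompact _ (AdaptedTop.extendedWeakTopology.{u, w} T (AdaptedTop.State.ofSet U hU) r) K →
        induced (Subtype.val : K → _)
              (AdaptedTop.adaptedTopology.{u, w} T (AdaptedTop.State.ofSet U hU) r) =
            induced (Subtype.val : K → _)
              (AdaptedTop.extendedWeakTopology.{u, w} T (AdaptedTop.State.ofSet U hU) r) ∧
          induced (Subtype.val : K → _)
              (AdaptedTop.extendedWeakTopology.{u, w} T (AdaptedTop.State.ofSet U hU) r) =
            induced (Subtype.val : K → _)
              (AdaptedTop.sigTopology.{u, w} (T := T) Λ (AdaptedTop.State.incl U hU) r) ∧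
          induced (Subtype.val : K → _)
              (AdaptedTop.sigTopology.{u, w} (T := T) Λ (AdaptedTop.State.incl U hU) r) =
            induced (Subtype.val : K → _)
              (AdaptedTop.sigDistTopology.{u, w} (T := T) Λ (AdaptedTop.State.incl U hU) r)) := by
  have hι : Continuous (AdaptedTop.State.incl U hU) := continuous_subtype_val
  have hi : Function.Injective (AdaptedTop.State.incl U hU) := Subtype.val_injective
  refine ⟨fun hc Λ hΛ => ?_, fun Λ hΛ K hK => ?_⟩
  · have : CompactSpace (AdaptedTop.State.ofSet U hU) := isCompact_iff_compactSpace.1 hc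
    -- Both kinds of signatures are continuous dilations. Boundedness comes from compactness of `U`
    -- in the classical case and from the normalization in the robust case.
    have h : (∀ k, AdaptedTop.IsDilation (N k (AdaptedTop.Aug (AdaptedTop.tensorSpace N V k)))
        (Λ k)) ∧ Λ.IsBounded T (AdaptedTop.State.ofSet U hU) := by
      rcases hΛ with rfl | hΛ
      · exact ⟨fun k => AdaptedTop.isDilation_id, AdaptedTop.Lift.isBounded_classical⟩
      · exact ⟨fun k => (hΛ k).isDilation, hΛ.isBounded⟩
    have key := AdaptedTop.topologies_eq_of_compactSpace.{u, w} h.1 h.2 hι hi r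
    exact ⟨key.1, key.2, AdaptedTop.sigTopology_eq_sigDistTopology Λ _ r⟩
  · have key := AdaptedTop.topologies_eq_on_isCompact.{u, w} (fun k => (hΛ k).isDilation)
      hΛ.isBounded hι hi r hK
    exact ⟨key.1, key.2, by rw [AdaptedTop.sigTopology_eq_sigDistTopology]⟩
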